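/- Theorem 5 (Grid based filtering/prediction and functionals of the state). Setting. Let $a<b$, $\mathcal Z=[a,b]^M$, and let $X_{-1},X_0,X_1,\dots$ be a process with $X_t\in\mathcal Z$ almost surely, on a probability space $(\Omega,\mathscr F,\mathcal P)$. Given the whole path of $X$, the observations $\mathbf y_0,\mathbf y_1,\dots$ in $\mathbb R^N$ are independent and $\mathbf y_t\sim\mathcal N(\boldsymbol\mu_t(X_t),\mathbf C_t(X_t))$, where $\mathbf C_t(x)=\boldsymbol\Sigma_t(x)+\sigma^2\mathbf I_N$, $\sigma\ge0$, and $\boldsymbol\Sigma_t(x)\succ0$ for $x\in\mathcal Z$. Assume that $\|\boldsymbol\mu_t(x)\|_2$ and $\lambda_{\max}(\mathbf C_t(x))$ are bounded uniformly in $t\in\mathbb N$ and $x\in\mathcal Z$, that $\inf_{t,x}\lambda_{\min}(\mathbf C_t(x))>1$, and that each $\boldsymbol\mu_t$ and each entry of each $\boldsymbol\Sigma_t$ is Lipschitz on $\mathcal Z$ for the $\ell_1$-norm. Let $\mathscr Y_t$ be the $\sigma$-algebra generated by $\mathbf y_0,\dots,\mathbf y_t$ and the null events. Quantization. For $L\ge1$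 divide $\mathcal Z$ into $L_S=L^M$ equal cells $\mathcal Z^1,\dots,\mathcal Z^{L_S}$ (products of $L$ intervals of equal length), with centres $x^1,\dots,x^{L_S}$; let $\mathcal Q_{L_S}$ map each point to the centre of its cell, and let $\mathcal Z_{L_S}(x)$ be the cell of $x$. Consider either (a) the Markovian quantization: $X_t=f(X_{t-1},W_t)$ for all $t\ge0$, almost surely, with $(W_t)$ i.i.d. with values in a set $\mathcal W$ and independent of $X_{-1}$, $f$ measurable with $f(\mathcal Z\times\mathcal W)\subseteq\mathcal Z$ and $\|f(x,w)-f(x',w)\|_1\le K(w)\|x-x'\|_1$ for $x,x'\in\mathcal Z$, $w\in\mathcal W$, where $K\ge0$ and $\sup_{\mathcal W}K<\infty$; put $X^{L_S}_{-1}=\mathcal Q_{L_S}(X_{-1})$, $X^{L_S}_t=\mathcal Q_{L_S}(f(X^{L_S}_{t-1},W_t))$; or (b) the marginal quantization: $X$ is a time-homogeneous Markov process with kernel $\mathcal K$, the law $\nu$ of $X_{-1}$ is invariant, and $\mathcal K$ is conditionally regular; put $X^{L_S}_t=\mathcal Q_{L_S}(X_t)$. Here conditionally regular means that there are measurable $\delta_{L_S}\ge0$,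 uniformly integrable with respect to $\nu$ and tending to $0$ $\nu$-a.e. as $L\to\infty$, such that for $\nu$-almost all $x$ and all $L$ either (type I) $|\mathcal K(\mathcal Z^i|x)-\mathcal K(\mathcal Z^i|\in\mathcal Z_{L_S}(x))|\le\delta_{L_S}(x)/L_S$ for all cells $\mathcal Z^i$, or (type II) $\mathcal K(\cdot|x)$ has a Lebesgue density $\kappa(\cdot|x)$, jointly measurable, and $|\kappa(y|x)-\kappa(y|\in\mathcal Z_{L_S}(x))|\le\delta_{L_S}(x)$ for almost every $y$ (one type for all $x$ and $L$), where $\mathcal K(A|\in\mathcal Z_{L_S}(x))$ and $\kappa(y|\in\mathcal Z_{L_S}(x))$ are the averages of $\mathcal K(A|\theta)$ and $\kappa(y|\theta)$ over $\theta\in\mathcal Z_{L_S}(x)$ with respect to $\nu$. Approximate filter. In both cases there is a column stochastic matrix $\boldsymbol P$ with $\boldsymbol P(i,j)=\mathcal P(X^{L_S}_t=x^i\mid X^{L_S}_{t-1}=x^j)$ for all $t\ge0$ with $\mathcal P(X^{L_S}_{t-1}=x^j)>0$; fix any such matrix for each $L$. With $\mathsf L_t(x,\mathbf y)=(\sqrt{2\pi})^N\mathcal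 N(\mathbf y;\boldsymbol\mu_t(x),\mathbf C_t(x))$, let $\boldsymbol\Lambda_t=\mathrm{diag}(\mathsf L_t(x^1,\mathbf y_t),\dots,\mathsf L_t(x^{L_S},\mathbf y_t))$, $\boldsymbol E_{-1}(j)=\mathcal P(X^{L_S}_{-1}=x^j)$ and $\boldsymbol E_t=\boldsymbol\Lambda_t\boldsymbol P\boldsymbol E_{t-1}$ for $t\ge0$. For functions $\boldsymbol\phi_t:\mathbb R^M\to\mathbb R^{M_{\phi_t}}$ and $\rho\in\mathbb N$ put $\boldsymbol\Phi_{t+\rho}=[\boldsymbol\phi_{t+\rho}(x^1)\ \dots\ \boldsymbol\phi_{t+\rho}(x^{L_S})]$ and $$\mathcal E^{L_S}(\boldsymbol\phi_{t+\rho}(X_{t+\rho})|\mathscr Y_t)=\boldsymbol\Phi_{t+\rho}\frac{\boldsymbol P^\rho\boldsymbol E_t}{\|\boldsymbol E_t\|_1}.$$ Claim. For every $T\in\mathbb N$ and every real $C\ge1$ there is a measurable $\widehat\Omega_T\subseteq\Omega$, the same for both quantizations and for all $\boldsymbol\phi$ and $\rho$, with $\mathcal P(\widehat\Omega_T)\ge1-(T+1)^{1-CN}e^{-CN}$,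 such that, in case (a) as well as in case (b), for all families of bounded continuous $\boldsymbol\phi_t$ and all $\rho\ge0$, and for suitable versions of the conditional expectations (not depending on $L$), $$\sup_{0\le t\le T}\ \sup_{\omega\in\widehat\Omega_T}\Big\|\mathcal E^{L_S}(\boldsymbol\phi_{t+\rho}(X_{t+\rho})|\mathscr Y_t)-\mathbb E\{\boldsymbol\phi_{t+\rho}(X_{t+\rho})|\mathscr Y_t\}\Big\|_1(\omega)\longrightarrow0\quad\text{as }L\to\infty.$$ -/

import Mathlib

open MeasureTheory ProbabilityTheory Filter Topology
open scoped ENNReal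

/-- The `ℓ₁`-norm of a real vector. -/
def l1 {ι : Type*} [Fintype ι] (v : ι → ℝ) : ℝ := ∑ i, |v i|

section Quantization

/-- The compact state space `𝒵 = [a, b]^M`. -/
def stateBox (M : ℕ) (a b : ℝ) : Set (Fin M → ℝ) := {x | ∀ m, x m ∈ Set.Icc a b}

/-- Multi-indices of the cells of the uniform partition of `[a, b]^M` with resolution `L = n + 1`
in each coordinate; there are `L_S = (n + 1) ^ M` of them. -/
abbrev GridIndex (M n : ℕ) : Type := Fin M → Fin (n + 1)

/-- The multi-index of the cell that contains `x`. In each coordinate `[a, b]` is split into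
`n + 1` intervals of equal length, the last one closed, the others closed on the left and open on
the right. (Points outside `[a, b]^M`, which never matter, are sent to some cell.) -/
noncomputable def cellIndex {M : ℕ} (a b : ℝ) (n : ℕ) (x : Fin M → ℝ) : GridIndex M n :=
  fun m => ⟨min ⌊(x m - a) / (b - a) * ((n : ℝ) + 1)⌋₊ n, Nat.lt_succ_of_le (min_le_right _ _)⟩

/-- The reconstruction point of a cell: its centre. -/
noncomputable def gridPoint {M : ℕ} (a b : ℝ) (n : ℕ) (l : GridIndex M n) : Fin M → ℝ :=
  fun m => a + (((l m : ℕ) : ℝ) + 1 / 2) * ((b - a) / ((n : ℝ) + 1))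

/-- The uniform quantizer `𝒬_{L_S}`. -/
noncomputable def quantizer {M : ℕ} (a b : ℝ) (n : ℕ) (x : Fin M → ℝ) : Fin M → ℝ :=
  gridPoint a b n (cellIndex a b n x)

/-- The cells `𝒵_{L_S}^l` of the uniform partition of `[a, b]^M`. -/
def cell {M : ℕ} (a b : ℝ) (n : ℕ) (l : GridIndex M n) : Set (Fin M → ℝ) :=
  {x | x ∈ stateBox M a b ∧ cellIndex a b n x = l}

/-- Marginal quantization of a state process: `X_t^{L_S} = 𝒬_{L_S}(X_t)`. -/
noncomputable def marginalQuantization {Ω : Type*} {M : ℕ} (a b : ℝ) (X : ℕ → Ω → Fin M → ℝ)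
    (n : ℕ) : ℕ → Ω → Fin M → ℝ :=
  fun s ω => quantizer a b n (X s ω)

/-- Markovian quantization: `X_{-1}^{L_S} = 𝒬_{L_S}(X_{-1})` and
`X_t^{L_S} = 𝒬_{L_S}(f(X_{t-1}^{L_S}, W_t))`. Position `0` carries the time `-1`, position `t + 1`
the time `t`. -/
noncomputable def markovianQuantization {Ω : Type*} {M MW : ℕ} (a b : ℝ)
    (f : (Fin M → ℝ) → (Fin MW → ℝ) → (Fin M → ℝ)) (W : ℕ → Ω → Fin MW → ℝ)
    (Xinit : Ω → Fin M → ℝ) (n : ℕ) : ℕ → Ω → Fin M → ℝ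
  | 0 => fun ω => quantizer a b n (Xinit ω)
  | t + 1 => fun ω =>
      quantizer a b n (f (markovianQuantization a b f W Xinit n t ω) (W t ω))

/-- `A` is the (column stochastic, time invariant) transition matrix of the quantized process `XL`:
`A(i, j) = 𝒫(X_t^{L_S} = x^i | X_{t-1}^{L_S} = x^j)` for every time `t` at which the conditioning
event is not null. Columns of grid points that are never charged are arbitrary probability
vectors. -/
structure IsTransitionMatrix {Ω : Type*} [MeasurableSpace Ω] (P : Measure Ω) {M : ℕ} (a b : ℝ)
    (n : ℕ) (XL : ℕ → Ω → Fin M → ℝ) (A : Matrix (GridIndex M n) (GridIndex M n) ℝ) : Prop where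
  nonneg : ∀ i j, 0 ≤ A i j
  sum_col : ∀ j, ∑ i, A i j = 1
  eq_cond : ∀ t i j, P {ω | XL t ω = gridPoint a b n j} ≠ 0 →
    A i j = (P[|{ω | XL t ω = gridPoint a b n j}]).real {ω | XL (t + 1) ω = gridPoint a b n i}

end Quantization

section Observations

/-- The density `𝒩(z; m, C)` of the (nondegenerate) `N`-variate Gaussian distribution with mean `m`
and covariance matrix `C`. -/
noncomputable def gaussianDensity {N : ℕ} (m : Fin N → ℝ) (C : Matrix (Fin N) (Fin N) ℝ)
    (z : Fin N → ℝ) : ℝ :=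
  (√((2 * Real.pi) ^ N * C.det))⁻¹ * Real.exp (-(1 / 2) * ((z - m) ⬝ᵥ (C⁻¹.mulVec (z - m))))

/-- The conditional covariance `C_t(x) = Σ_t(x) + σ² I` of the observations. -/
def obsCov {M N : ℕ} (S : ℕ → (Fin M → ℝ) → Matrix (Fin N) (Fin N) ℝ) (σ : ℝ)
    (t : ℕ) (x : Fin M → ℝ) : Matrix (Fin N) (Fin N) ℝ :=
  S t x + σ ^ 2 • (1 : Matrix (Fin N) (Fin N) ℝ)

/-- The likelihood `L_t(x, z) = (√(2π))^N 𝒩(z; μ_t(x), C_t(x))`. -/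
noncomputable def likelihood {M N : ℕ} (μ : ℕ → (Fin M → ℝ) → Fin N → ℝ)
    (S : ℕ → (Fin M → ℝ) → Matrix (Fin N) (Fin N) ℝ) (σ : ℝ)
    (t : ℕ) (x : Fin M → ℝ) (z : Fin N → ℝ) : ℝ :=
  (√(2 * Real.pi)) ^ N * gaussianDensity (μ t x) (obsCov S σ t x) z

/-- The partially observed system: a state process with values in `[a, b]^M` and conditionally
Gaussian observations. Position `0` of `X` carries the initial state `X_{-1}`, and `X (t + 1)` is
the state `X_t`, observed through `y t`. -/
structure IsObservedSystem {Ω : Type*} [MeasurableSpace Ω] (P : Measure Ω) {M N : ℕ} (a b : ℝ)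
    (X : ℕ → Ω → Fin M → ℝ) (y : ℕ → Ω → Fin N → ℝ)
    (μ : ℕ → (Fin M → ℝ) → Fin N → ℝ) (S : ℕ → (Fin M → ℝ) → Matrix (Fin N) (Fin N) ℝ)
    (σ : ℝ) : Prop where
  lt : a < b
  sigma_nonneg : 0 ≤ σ
  measurable_state : ∀ s, Measurable (X s)
  measurable_obs : ∀ t, Measurable (y t)
  /-- the state is supported in `[a, b]^M` -/
  mem_box : ∀ s, ∀ᵐ ω ∂P, X s ω ∈ stateBox M a b
  /-- given the whole state path, the observations `y_0, …, y_k` are independent, and `y_i` is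
  Gaussian with mean `μ_i(X_i)` and covariance `C_i(X_i)` -/
  obs_law : ∀ (k : ℕ) (A : Set (ℕ → Fin M → ℝ)) (B : ℕ → Set (Fin N → ℝ)),
    MeasurableSet A → (∀ i, MeasurableSet (B i)) →
    P {ω | (fun s => X s ω) ∈ A ∧ ∀ i ≤ k, y i ω ∈ B i} =
      ∫⁻ ω in {ω | (fun s => X s ω) ∈ A}, ∏ i ∈ Finset.range (k + 1),
        (∫⁻ z in B i, ENNReal.ofReal
          (gaussianDensity (μ i (X (i + 1) ω)) (obsCov S σ i (X (i + 1) ω)) z)) ∂P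
  posDef : ∀ t, ∀ x ∈ stateBox M a b, (S t x).PosDef
  /-- boundedness of the means, uniformly in time -/
  mean_bounded : ∃ μsup : ℝ, ∀ t, ∀ x ∈ stateBox M a b, √(∑ i, μ t x i ^ 2) ≤ μsup
  /-- boundedness of the largest eigenvalue of `C_t(x)`, uniformly in time -/
  eig_upper : ∃ lsup : ℝ, ∀ t, ∀ x ∈ stateBox M a b, ∀ l ∈ spectrum ℝ (obsCov S σ t x), l ≤ lsup
  /-- the infimum of the smallest eigenvalues of all `C_t(x)` exceeds `1` -/
  eig_lower : ∃ linf : ℝ, 1 < linf ∧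
    ∀ t, ∀ x ∈ stateBox M a b, ∀ l ∈ spectrum ℝ (obsCov S σ t x), linf ≤ l
  /-- Lipschitz continuity of the means with respect to the `ℓ₁`-norm -/
  mean_lipschitz : ∀ t, ∃ c : ℝ, ∀ x ∈ stateBox M a b, ∀ x' ∈ stateBox M a b,
    l1 (μ t x - μ t x') ≤ c * l1 (x - x')
  /-- elementwise Lipschitz continuity of the covariances with respect to the `ℓ₁`-norm -/
  cov_lipschitz : ∀ t, ∃ c : ℝ, ∀ i j, ∀ x ∈ stateBox M a b, ∀ x' ∈ stateBox M a b,
    |S t x i j - S t x' i j| ≤ c * l1 (x - x')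

/-- The complete natural filtration of a process: the `σ`-algebra generated by `y_0, …, y_t` and
the null events. -/
abbrev completeHistory {Ω : Type*} [MeasurableSpace Ω] (P : Measure Ω) {N : ℕ}
    (y : ℕ → Ω → Fin N → ℝ) (t : ℕ) : MeasurableSpace Ω :=
  (⨆ i ∈ Set.Iic t, MeasurableSpace.comap (y i) inferInstance) ⊔
    MeasurableSpace.generateFrom {s | MeasurableSet s ∧ P s = 0}

end Observations

section StateModels

/-- The state follows the recursion `X_t = f(X_{t-1}, W_t)` with `W` white (i.i.d.) noise with
values in `𝓦`, independent of `X_{-1}`, and `f : 𝒵 × 𝓦 → 𝒵` is Lipschitz in its first argument,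
with Lipschitz constants that are bounded on `𝓦`. -/
structure IsLipschitzModel {Ω : Type*} [MeasurableSpace Ω] (P : Measure Ω) {M MW : ℕ} (a b : ℝ)
    (X : ℕ → Ω → Fin M → ℝ) (f : (Fin M → ℝ) → (Fin MW → ℝ) → (Fin M → ℝ))
    (WS : Set (Fin MW → ℝ)) (W : ℕ → Ω → Fin MW → ℝ) : Prop where
  measurable_noise : ∀ t, Measurable (W t)
  mem_noise : ∀ t, ∀ᵐ ω ∂P, W t ω ∈ WS
  indep_noise : iIndepFun W P
  ident_noise : ∀ t, IdentDistrib (W t) (W 0) P P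
  indep_init : IndepFun (X 0) (fun ω t => W t ω) P
  measurable_map : Measurable (Function.uncurry f)
  maps_box : ∀ x ∈ stateBox M a b, ∀ w ∈ WS, f x w ∈ stateBox M a b
  state_eq : ∀ t, ∀ᵐ ω ∂P, X (t + 1) ω = f (X t ω) (W t ω)
  lipschitz : ∃ (K : (Fin MW → ℝ) → ℝ) (Ksup : ℝ), ∀ w ∈ WS, 0 ≤ K w ∧ K w ≤ Ksup ∧
    ∀ x ∈ stateBox M a b, ∀ x' ∈ stateBox M a b, l1 (f x w - f x' w) ≤ K w * l1 (x - x')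

/-- `X` is a Markov process with transition kernel `κ`, started from an invariant distribution. -/
structure IsStationaryMarkov {Ω : Type*} [MeasurableSpace Ω] (P : Measure Ω) {M : ℕ}
    (X : ℕ → Ω → Fin M → ℝ) (κ : Kernel (Fin M → ℝ) (Fin M → ℝ)) : Prop where
  markov : ∀ (s : ℕ) (A : Set (Fin M → ℝ)), MeasurableSet A →
    P[(X (s + 1) ⁻¹' A).indicator (fun _ => (1 : ℝ)) |
        ⨆ i ∈ Set.Iic s, MeasurableSpace.comap (X i) inferInstance]
      =ᵐ[P] fun ω => (κ (X s ω)).real A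
  invariant : Kernel.Invariant κ (P.map (X 0))

/-- The cumulative kernel `𝒦(A | ∈ 𝒵_{L_S}(x))`: the average of `𝒦(A | ·)` under `ν` over the cell
of `x`. -/
noncomputable def cumulativeKernel {M : ℕ} (κ : Kernel (Fin M → ℝ) (Fin M → ℝ))
    (ν : Measure (Fin M → ℝ)) (a b : ℝ) (n : ℕ) (A : Set (Fin M → ℝ)) (x : Fin M → ℝ) : ℝ :=
  (∫ θ in cell a b n (cellIndex a b n x), (κ θ).real A ∂ν) /
    ν.real (cell a b n (cellIndex a b n x))

/-- The cumulative kernel density: the average of the densities `k(y | ·)` under `ν` over the cell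
of `x`; here `k x y` is the density at `y` of the kernel at `x`. -/
noncomputable def cumulativeDensity {M : ℕ} (k : (Fin M → ℝ) → (Fin M → ℝ) → ℝ)
    (ν : Measure (Fin M → ℝ)) (a b : ℝ) (n : ℕ) (y x : Fin M → ℝ) : ℝ :=
  (∫ θ in cell a b n (cellIndex a b n x), k θ y ∂ν) /
    ν.real (cell a b n (cellIndex a b n x))

/-- A nonnegative, `ν`-uniformly integrable sequence that tends to `0` `ν`-almost everywhere. -/
structure IsVanishingUI {M : ℕ} (ν : Measure (Fin M → ℝ)) (δ : ℕ → (Fin M → ℝ) → ℝ) : Prop where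
  nonneg : ∀ n x, 0 ≤ δ n x
  ui : UniformIntegrable δ 1 ν
  tendsto : ∀ᵐ x ∂ν, Tendsto (fun n => δ n x) atTop (𝓝 0)

/-- Conditional regularity of type I; the sequence is indexed by the resolution, and
`L_S = (n + 1) ^ M`. -/
def IsCRT1 {M : ℕ} (κ : Kernel (Fin M → ℝ) (Fin M → ℝ)) (ν : Measure (Fin M → ℝ))
    (a b : ℝ) : Prop :=
  ∃ δ : ℕ → (Fin M → ℝ) → ℝ, IsVanishingUI ν δ ∧
    ∀ᵐ x ∂ν, ∀ (n : ℕ) (l : GridIndex M n),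
      |(κ x).real (cell a b n l) - cumulativeKernel κ ν a b n (cell a b n l) x| ≤
        δ n x / ((n : ℝ) + 1) ^ M

/-- Conditional regularity of type II. -/
def IsCRT2 {M : ℕ} (κ : Kernel (Fin M → ℝ) (Fin M → ℝ)) (ν : Measure (Fin M → ℝ))
    (a b : ℝ) : Prop :=
  ∃ k : (Fin M → ℝ) → (Fin M → ℝ) → ℝ, Measurable (Function.uncurry k) ∧ (∀ x y, 0 ≤ k x y) ∧
    (∀ᵐ x ∂ν, κ x = volume.withDensity fun y => ENNReal.ofReal (k x y)) ∧
    ∃ δ : ℕ → (Fin M → ℝ) → ℝ, IsVanishingUI ν δ ∧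
      ∀ᵐ x ∂ν, ∀ n : ℕ, ∀ᵐ y, |k x y - cumulativeDensity k ν a b n y x| ≤ δ n x

end StateModels

section Filters

/-- The grid recursion, driven by an observation path `z`: the value at `0` is
`E_{-1}(l) = 𝒫(X_{-1}^{L_S} = x^l)`, the value at `t + 1` is
`E_t = diag(L_t(x^l, z_t)) A E_{t-1}`. -/
noncomputable def gridRecursion {Ω : Type*} [MeasurableSpace Ω] (P : Measure Ω) {M N : ℕ}
    (a b : ℝ) (μ : ℕ → (Fin M → ℝ) → Fin N → ℝ)
    (S : ℕ → (Fin M → ℝ) → Matrix (Fin N) (Fin N) ℝ) (σ : ℝ) (Xinit : Ω → Fin M → ℝ) (n : ℕ)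
    (A : Matrix (GridIndex M n) (GridIndex M n) ℝ) (z : ℕ → Fin N → ℝ) : ℕ → GridIndex M n → ℝ
  | 0 => fun l => P.real {ω | quantizer a b n (Xinit ω) = gridPoint a b n l}
  | t + 1 =>
      (Matrix.diagonal (fun l => likelihood μ S σ t (gridPoint a b n l) (z t)) * A).mulVec
        (gridRecursion P a b μ S σ Xinit n A z t)

/-- The matrix `Φ = [φ(x^1) … φ(x^{L_S})]`. -/
noncomputable def gridMatrix {M d : ℕ} (a b : ℝ) (n : ℕ) (φ : (Fin M → ℝ) → Fin d → ℝ) :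
    Matrix (Fin d) (GridIndex M n) ℝ :=
  Matrix.of fun i l => φ (gridPoint a b n l) i

/-- The grid based estimate `Φ_{t+ρ} (A^ρ E_t) / ‖E_t‖₁` of `φ_{t+ρ}(X_{t+ρ})` at time `t`, for the
observation path `z`. -/
noncomputable def gridEstimate {Ω : Type*} [MeasurableSpace Ω] (P : Measure Ω) {M N : ℕ}
    (a b : ℝ) (μ : ℕ → (Fin M → ℝ) → Fin N → ℝ)
    (S : ℕ → (Fin M → ℝ) → Matrix (Fin N) (Fin N) ℝ) (σ : ℝ) (Xinit : Ω → Fin M → ℝ)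
    {d : ℕ → ℕ} (φ : ∀ t, (Fin M → ℝ) → Fin (d t) → ℝ) (ρ n : ℕ)
    (A : Matrix (GridIndex M n) (GridIndex M n) ℝ) (z : ℕ → Fin N → ℝ) (t : ℕ) :
    Fin (d (t + ρ)) → ℝ :=
  (gridMatrix a b n (φ (t + ρ))).mulVec
    ((l1 (gridRecursion P a b μ S σ Xinit n A z (t + 1)))⁻¹ •
      (A ^ ρ).mulVec (gridRecursion P a b μ S σ Xinit n A z (t + 1)))

/-- `g t` is, for every `t`, a version of the optimal filter or predictor
`𝔼[φ_{t+ρ}(X_{t+ρ}) | 𝒴_t]`. -/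
def IsOptimalEstimator {Ω : Type*} [MeasurableSpace Ω] (P : Measure Ω) {M N : ℕ}
    (X : ℕ → Ω → Fin M → ℝ) (y : ℕ → Ω → Fin N → ℝ)
    {d : ℕ → ℕ} (φ : ∀ t, (Fin M → ℝ) → Fin (d t) → ℝ) (ρ : ℕ)
    (g : ∀ t, Ω → Fin (d (t + ρ)) → ℝ) : Prop :=
  ∀ t, StronglyMeasurable[completeHistory P y t] (g t) ∧
    g t =ᵐ[P] P[fun ω => φ (t + ρ) (X (t + ρ + 1) ω) | completeHistory P y t]

/-- With the quantized processes `XL n` (one for each resolution), the transition matrices are well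
defined, and, for all transition matrices, all families of bounded continuous functions `φ_t` and
all horizons `ρ`, the grid based estimates converge to the optimal ones as the resolution tends to
infinity, uniformly over the times `0, …, T` and over the event `G`. -/
def GridEstimatesConverge {Ω : Type*} [MeasurableSpace Ω] (P : Measure Ω) {M N : ℕ}
    (a b : ℝ) (X : ℕ → Ω → Fin M → ℝ) (y : ℕ → Ω → Fin N → ℝ)
    (μ : ℕ → (Fin M → ℝ) → Fin N → ℝ) (S : ℕ → (Fin M → ℝ) → Matrix (Fin N) (Fin N) ℝ) (σ : ℝ)
    (XL : ℕ → ℕ → Ω → Fin M → ℝ) (T : ℕ) (G : Set Ω) : Prop :=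
  (∀ n, ∃ A, IsTransitionMatrix P a b n (XL n) A) ∧
  ∀ A : ∀ n, Matrix (GridIndex M n) (GridIndex M n) ℝ,
    (∀ n, IsTransitionMatrix P a b n (XL n) (A n)) →
  ∀ (d : ℕ → ℕ) (φ : ∀ t, (Fin M → ℝ) → Fin (d t) → ℝ),
    (∀ t, Continuous (φ t)) → (∀ t, ∃ B : ℝ, ∀ x, l1 (φ t x) ≤ B) →
  ∀ ρ : ℕ, ∃ g : ∀ t, Ω → Fin (d (t + ρ)) → ℝ, IsOptimalEstimator P X y φ ρ g ∧
    Tendsto (fun n => ⨆ t ∈ Set.Iic T, ⨆ ω ∈ G, ENNReal.ofReal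
        (l1 (gridEstimate P a b μ S σ (X 0) φ ρ n (A n) (fun i => y i ω) t - g t ω)))
      atTop (𝓝 0)

end Filters

/-! Both the grid estimate and the optimal estimate are functions of the observation path `z`. The
law of the observations on the Polish space of sequences is tight, so for every `ε > 0` a compact
set `K` of paths carries mass at least `1 - ε` (`IsObservedSystem.exists_isCompact_obs`). The event
is `{y ∈ K}`; it knows nothing of the quantization, of `φ` or of `ρ`. Uniform convergence on `K`
follows from convergence in the resolution and in `z → z₀` jointly, for each `z₀`
(`IsCompact.eventually_forall_le_of_tendsto`).

On the optimal side, Bayes' formula (`bayesEstimate_ae_eq_condExp`) gives a version of the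
conditional expectation: a quotient of means over the state path, weighted with the product of the
likelihoods. The likelihood, composed with the retraction onto the box, is jointly continuous,
positive and bounded, so the quotient is defined for every `z` and continuous in `z`. What remains
is that the unnormalized sums `gridMean` tend to `weightedMean`.

For the Markovian quantization, the quantized process is itself a Markov chain with the given
matrix. Hence `gridMean` is exactly the weighted mean along the quantized path
(`IsLipschitzModel.gridMean_eq`). That path converges almost surely to the true one, and dominated
convergence finishes.

The marginal quantization need not be Markov, so no such identity is available. Instead the grid
weights are tested against grid functions that converge in `L¹(ν)` (`WeightsTendsto`), and the
recursion is moved onto the test functions. One backward step of the matrix is a cell average of one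
backward step of the kernel (`vecMul_mul_measureReal`). The kernel contracts `L¹(ν)` because `ν` is
invariant (`integral_abs_kernel_sub_le`), and cell averaging preserves `L¹` limits because bounded
continuous functions are dense (`tendsto_integral_abs_cell_sub`). Multiplication by the likelihood
preserves the class of test functions as well. -/

lemma abs_le_l1 {ι : Type*} [Fintype ι] (v : ι → ℝ) (i : ι) : |v i| ≤ l1 v :=
  Finset.single_le_sum (f := fun i => |v i|) (fun _ _ => abs_nonneg _) (Finset.mem_univ i)

lemma l1_nonneg {ι : Type*} [Fintype ι] (v : ι → ℝ) : 0 ≤ l1 v :=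
  Finset.sum_nonneg fun _ _ => abs_nonneg _

lemma continuous_l1 {ι : Type*} [Fintype ι] : Continuous (l1 : (ι → ℝ) → ℝ) := by
  unfold l1; fun_prop

/-- A function on a set of real vectors that is Lipschitz for the `ℓ₁`-norm is continuous. -/
lemma continuousOn_of_l1_lipschitz {ι : Type*} [Fintype ι] {s : Set (ι → ℝ)} {f : (ι → ℝ) → ℝ}
    {c : ℝ} (h : ∀ x ∈ s, ∀ x' ∈ s, |f x - f x'| ≤ c * l1 (x - x')) : ContinuousOn f s := by
  intro x hx
  rw [ContinuousWithinAt, tendsto_iff_dist_tendsto_zero]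
  have h0 : Tendsto (fun x' => c * l1 (x' - x)) (𝓝[s] x) (𝓝 0) := by
    have : Continuous fun x' : ι → ℝ => c * l1 (x' - x) :=
      continuous_const.mul (continuous_l1.comp (continuous_id.sub continuous_const))
    simpa [l1] using (this.tendsto x).mono_left nhdsWithin_le_nhds
  refine squeeze_zero' (Eventually.of_forall fun _ => dist_nonneg) ?_ h0
  filter_upwards [self_mem_nhdsWithin] with x' hx'
  exact h x' hx' x hx

/-! ### Geometry of the box and of the uniform quantizer. -/

section Box

variable {M : ℕ} {a b : ℝ}

/-- The nearest point retraction onto `[a, b]^M`. -/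
def clampBox (a b : ℝ) (x : Fin M → ℝ) : Fin M → ℝ := fun m => max a (min b (x m))

lemma continuous_clampBox : Continuous (clampBox a b : (Fin M → ℝ) → Fin M → ℝ) := by
  unfold clampBox; fun_prop

lemma clampBox_mem (hab : a ≤ b) (x : Fin M → ℝ) : clampBox a b x ∈ stateBox M a b :=
  fun _ => ⟨le_max_left _ _, max_le hab (min_le_left _ _)⟩

lemma clampBox_eq {x : Fin M → ℝ} (hx : x ∈ stateBox M a b) : clampBox a b x = x := by
  funext m
  simp [clampBox, (hx m).1, (hx m).2]

lemma isCompact_stateBox : IsCompact (stateBox M a b) := by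
  have : stateBox M a b = Set.univ.pi fun _ => Set.Icc a b := by
    ext; simp only [stateBox, Set.mem_ofPred_eq, Set.mem_univ_pi]
  rw [this]
  exact isCompact_univ_pi fun _ => isCompact_Icc

lemma measurable_cellIndex (n : ℕ) : Measurable (cellIndex (M := M) a b n) := by
  refine measurable_pi_lambda _ fun m => ?_
  have h : Measurable fun x : Fin M → ℝ => min ⌊(x m - a) / (b - a) * ((n : ℝ) + 1)⌋₊ n :=
    (Nat.measurable_floor.comp (by fun_prop)).min measurable_const
  refine measurable_to_countable' fun k => ?_
  have : (fun x : Fin M → ℝ => cellIndex a b n x m) ⁻¹' {k} =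
      (fun x : Fin M → ℝ => min ⌊(x m - a) / (b - a) * ((n : ℝ) + 1)⌋₊ n) ⁻¹' {(k : ℕ)} := by
    ext x; simp [cellIndex, Fin.ext_iff]
  rw [this]
  exact h (measurableSet_singleton _)

lemma measurable_quantizer (n : ℕ) : Measurable (quantizer (M := M) a b n) :=
  (measurable_of_countable _).comp (measurable_cellIndex n)

lemma gridPoint_injective (hab : a < b) (n : ℕ) :
    Function.Injective (gridPoint (M := M) a b n) := by
  intro k l h
  funext m
  have hm := congrFun h m
  have hn : (b - a) / ((n : ℝ) + 1) ≠ 0 := (div_pos (sub_pos.2 hab) (by positivity)).ne'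
  simp only [gridPoint, add_right_inj, mul_eq_mul_right_iff, hn, or_false, add_left_inj,
    Nat.cast_inj] at hm
  exact Fin.ext hm

lemma gridPoint_mem (hab : a < b) (n : ℕ) (l : GridIndex M n) :
    gridPoint a b n l ∈ stateBox M a b := by
  intro m
  have hn : 0 < (n : ℝ) + 1 := by positivity
  have hl : ((l m : ℕ) : ℝ) ≤ n := by exact_mod_cast Nat.lt_succ_iff.1 (l m).2
  have hd : 0 ≤ (b - a) / ((n : ℝ) + 1) := (div_pos (sub_pos.2 hab) hn).le
  constructor
  · have : 0 ≤ (((l m : ℕ) : ℝ) + 1 / 2) * ((b - a) / ((n : ℝ) + 1)) := by positivity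
    simpa [gridPoint] using this
  · have h1 : (((l m : ℕ) : ℝ) + 1 / 2) * ((b - a) / ((n : ℝ) + 1)) ≤
        ((n : ℝ) + 1) * ((b - a) / ((n : ℝ) + 1)) :=
      mul_le_mul_of_nonneg_right (by linarith) hd
    rw [mul_div_cancel₀ _ hn.ne'] at h1
    simp only [gridPoint]
    linarith

lemma quantizer_eq_gridPoint_iff (hab : a < b) (n : ℕ) (x : Fin M → ℝ) (l : GridIndex M n) :
    quantizer a b n x = gridPoint a b n l ↔ cellIndex a b n x = l :=
  (gridPoint_injective hab n).eq_iff

/-- The quantization error in each coordinate is at most the width of the cells. -/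
lemma abs_quantizer_sub_le (hab : a < b) (n : ℕ) {x : Fin M → ℝ} (hx : x ∈ stateBox M a b)
    (m : Fin M) : |quantizer a b n x m - x m| ≤ (b - a) / ((n : ℝ) + 1) := by
  have hn : 0 < (n : ℝ) + 1 := by positivity
  have hba := sub_pos.2 hab
  set h := (b - a) / ((n : ℝ) + 1) with hh
  have hpos : 0 < h := div_pos hba hn
  set u := (x m - a) / (b - a) * ((n : ℝ) + 1) with hu
  have hxu : x m = a + u * h := by rw [hu, hh]; field_simp; ring
  have hu0 : 0 ≤ u := mul_nonneg (div_nonneg (sub_nonneg.2 (hx m).1) hba.le) hn.le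
  have hu1 : u ≤ (n : ℝ) + 1 := by
    have : (x m - a) / (b - a) ≤ 1 := (div_le_one hba).2 (by linarith [(hx m).2])
    rw [hu]
    nlinarith
  -- `u` is the position in units of the cell width. The true bound is 1/2; 1 suffices. The second
  -- case contains the right endpoint `u = n + 1`, which the truncation puts into the last cell.
  have key : |((min ⌊u⌋₊ n : ℕ) : ℝ) + 1 / 2 - u| ≤ 1 := by
    rcases le_total ⌊u⌋₊ n with hle | hle
    · rw [min_eq_left hle, abs_le]
      constructor <;> linarith [Nat.floor_le hu0, Nat.lt_floor_add_one u]
    · have : (n : ℝ) ≤ u := (Nat.le_floor_iff hu0).1 hle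
      rw [min_eq_right hle, abs_le]
      constructor <;> linarith
  have : quantizer a b n x m - x m = (((min ⌊u⌋₊ n : ℕ) : ℝ) + 1 / 2 - u) * h := by
    rw [hxu]
    simp only [quantizer, gridPoint, cellIndex, ← hu, ← hh]
    ring
  rw [this, abs_mul, abs_of_pos hpos]
  exact mul_le_of_le_one_left hpos.le key

lemma tendsto_cellWidth (a b : ℝ) :
    Tendsto (fun n : ℕ => (b - a) / ((n : ℝ) + 1)) atTop (𝓝 0) := by
  simpa [div_eq_mul_inv] using
    (tendsto_one_div_add_atTop_nhds_zero_nat (𝕜 := ℝ)).const_mul (b - a)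

lemma tendsto_quantizer (hab : a < b) {x : Fin M → ℝ} (hx : x ∈ stateBox M a b) :
    Tendsto (fun n => quantizer a b n x) atTop (𝓝 x) := by
  rw [tendsto_pi_nhds]
  intro m
  rw [tendsto_iff_dist_tendsto_zero]
  exact squeeze_zero (fun _ => dist_nonneg) (fun n => abs_quantizer_sub_le hab n hx m)
    (tendsto_cellWidth a b)

end Box

/-! ### Continuity, positivity and boundedness of the likelihoods and of their products along paths.
-/

section Likelihood

variable {Ω : Type*} [MeasurableSpace Ω] {P : Measure Ω} {M N : ℕ} {a b : ℝ}
  {X : ℕ → Ω → Fin M → ℝ} {y : ℕ → Ω → Fin N → ℝ} {μ : ℕ → (Fin M → ℝ) → Fin N → ℝ}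
  {S : ℕ → (Fin M → ℝ) → Matrix (Fin N) (Fin N) ℝ} {σ : ℝ}

/-- The likelihood, extended from `[a, b]^M` to all states by the retraction onto the box. -/
noncomputable def boxLikelihood (a b : ℝ) (μ : ℕ → (Fin M → ℝ) → Fin N → ℝ)
    (S : ℕ → (Fin M → ℝ) → Matrix (Fin N) (Fin N) ℝ) (σ : ℝ) (t : ℕ) (x : Fin M → ℝ)
    (z : Fin N → ℝ) : ℝ :=
  likelihood μ S σ t (clampBox a b x) z

lemma boxLikelihood_eq {t : ℕ} {x : Fin M → ℝ} (hx : x ∈ stateBox M a b) (z : Fin N → ℝ) :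
    boxLikelihood a b μ S σ t x z = likelihood μ S σ t x z := by
  rw [boxLikelihood, clampBox_eq hx]

namespace IsObservedSystem

lemma posDef_obsCov (h : IsObservedSystem P a b X y μ S σ) (t : ℕ) {x : Fin M → ℝ}
    (hx : x ∈ stateBox M a b) : (obsCov S σ t x).PosDef :=
  (h.posDef t x hx).add_posSemidef (Matrix.PosSemidef.one.smul (sq_nonneg σ))

lemma continuous_mean (h : IsObservedSystem P a b X y μ S σ) (t : ℕ) :
    Continuous fun x => μ t (clampBox a b x) := by
  obtain ⟨c, hc⟩ := h.mean_lipschitz t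
  refine continuous_pi fun i => ?_
  have : ContinuousOn (fun x => μ t x i) (stateBox M a b) :=
    continuousOn_of_l1_lipschitz fun x hx x' hx' =>
      (abs_le_l1 (μ t x - μ t x') i).trans (hc x hx x' hx')
  exact this.comp_continuous continuous_clampBox (clampBox_mem h.lt.le)

lemma continuous_obsCov (h : IsObservedSystem P a b X y μ S σ) (t : ℕ) :
    Continuous fun x => obsCov S σ t (clampBox a b x) := by
  obtain ⟨c, hc⟩ := h.cov_lipschitz t
  refine Continuous.add (continuous_pi fun i => continuous_pi fun j => ?_) continuous_const
  have : ContinuousOn (fun x => S t x i j) (stateBox M a b) :=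
    continuousOn_of_l1_lipschitz (hc i j)
  exact this.comp_continuous continuous_clampBox (clampBox_mem h.lt.le)

lemma continuous_normalization (h : IsObservedSystem P a b X y μ S σ) (t : ℕ) :
    Continuous fun x => (√((2 * Real.pi) ^ N * (obsCov S σ t (clampBox a b x)).det))⁻¹ := by
  refine Continuous.inv₀ ?_ fun x => ?_
  · exact Real.continuous_sqrt.comp (continuous_const.mul (h.continuous_obsCov t).matrix_det)
  · have := (h.posDef_obsCov t (clampBox_mem h.lt.le x)).det_pos
    positivity

lemma continuous_gaussianDensity (h : IsObservedSystem P a b X y μ S σ) (t : ℕ) :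
    Continuous fun p : (Fin M → ℝ) × (Fin N → ℝ) =>
      gaussianDensity (μ t (clampBox a b p.1)) (obsCov S σ t (clampBox a b p.1)) p.2 := by
  have hinv : Continuous fun x => (obsCov S σ t (clampBox a b x))⁻¹ := by
    -- The inverse is the adjugate divided by the determinant, which is positive on the box.
    simp_rw [Matrix.inv_def, Ring.inverse_eq_inv']
    refine Continuous.smul (Continuous.inv₀ (h.continuous_obsCov t).matrix_det fun x => ?_)
      (h.continuous_obsCov t).matrix_adjugate
    exact (h.posDef_obsCov t (clampBox_mem h.lt.le x)).det_pos.ne'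
  have hz : Continuous fun p : (Fin M → ℝ) × (Fin N → ℝ) => p.2 - μ t (clampBox a b p.1) :=
    continuous_snd.sub ((h.continuous_mean t).comp continuous_fst)
  exact ((h.continuous_normalization t).comp continuous_fst).mul
    (Real.continuous_exp.comp (continuous_const.mul
      (hz.dotProduct ((hinv.comp continuous_fst).matrix_mulVec hz))))

lemma continuous_boxLikelihood (h : IsObservedSystem P a b X y μ S σ) (t : ℕ) :
    Continuous fun p : (Fin M → ℝ) × (Fin N → ℝ) => boxLikelihood a b μ S σ t p.1 p.2 :=
  continuous_const.mul (h.continuous_gaussianDensity t)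

lemma gaussianDensity_pos (h : IsObservedSystem P a b X y μ S σ) (t : ℕ) {x : Fin M → ℝ}
    (hx : x ∈ stateBox M a b) (z : Fin N → ℝ) :
    0 < gaussianDensity (μ t x) (obsCov S σ t x) z := by
  have := (h.posDef_obsCov t hx).det_pos
  unfold gaussianDensity
  positivity

lemma likelihood_pos (h : IsObservedSystem P a b X y μ S σ) (t : ℕ) {x : Fin M → ℝ}
    (hx : x ∈ stateBox M a b) (z : Fin N → ℝ) : 0 < likelihood μ S σ t x z :=
  mul_pos (by positivity) (h.gaussianDensity_pos t hx z)

lemma boxLikelihood_pos (h : IsObservedSystem P a b X y μ S σ) (t : ℕ) (x : Fin M → ℝ)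
    (z : Fin N → ℝ) : 0 < boxLikelihood a b μ S σ t x z :=
  h.likelihood_pos t (clampBox_mem h.lt.le x) z

/-- The exponential factor is at most 1 because the inverse covariance is positive semidefinite, and
the normalizing factor is continuous on a compact box. -/
lemma exists_boxLikelihood_le (h : IsObservedSystem P a b X y μ S σ) (t : ℕ) :
    ∃ B, ∀ x z, boxLikelihood a b μ S σ t x z ≤ B := by
  obtain ⟨B, hB⟩ := ((isCompact_stateBox (M := M) (a := a) (b := b)).image
    (h.continuous_normalization t)).bddAbove
  refine ⟨√(2 * Real.pi) ^ N * B, fun x z => ?_⟩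
  have hx := clampBox_mem h.lt.le x
  have h1 : (√((2 * Real.pi) ^ N * (obsCov S σ t (clampBox a b x)).det))⁻¹ ≤ B := by
    refine hB ⟨clampBox a b x, hx, ?_⟩
    simp only [clampBox_eq hx]
  refine mul_le_mul_of_nonneg_left (le_trans (mul_le_of_le_one_right (by positivity) ?_) h1)
    (by positivity)
  rw [Real.exp_le_one_iff]
  have := (h.posDef_obsCov t hx).inv.posSemidef.dotProduct_mulVec_nonneg
    (z - μ t (clampBox a b x))
  simp only [star_trivial] at this
  linarith

end IsObservedSystem

/-- The product of the likelihoods of the observations `z_0, …, z_{t-1}` along a state path. -/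
@[irreducible]
noncomputable def pathWeight (a b : ℝ) (μ : ℕ → (Fin M → ℝ) → Fin N → ℝ)
    (S : ℕ → (Fin M → ℝ) → Matrix (Fin N) (Fin N) ℝ) (σ : ℝ) (x : ℕ → Fin M → ℝ)
    (z : ℕ → Fin N → ℝ) (t : ℕ) : ℝ :=
  ∏ i ∈ Finset.range t, boxLikelihood a b μ S σ i (x (i + 1)) (z i)

lemma pathWeight_succ (x : ℕ → Fin M → ℝ) (z : ℕ → Fin N → ℝ) (t : ℕ) :
    pathWeight a b μ S σ x z (t + 1) =
      pathWeight a b μ S σ x z t * boxLikelihood a b μ S σ t (x (t + 1)) (z t) := by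
  simp only [pathWeight, Finset.prod_range_succ]

namespace IsObservedSystem

lemma pathWeight_pos (h : IsObservedSystem P a b X y μ S σ) (x : ℕ → Fin M → ℝ)
    (z : ℕ → Fin N → ℝ) (t : ℕ) : 0 < pathWeight a b μ S σ x z t := by
  rw [pathWeight]
  exact Finset.prod_pos fun _ _ => h.boxLikelihood_pos _ _ _

lemma exists_pathWeight_le (h : IsObservedSystem P a b X y μ S σ) (t : ℕ) :
    ∃ B, ∀ x z, pathWeight a b μ S σ x z t ≤ B := by
  choose B hB using h.exists_boxLikelihood_le
  refine ⟨∏ i ∈ Finset.range t, B i, fun x z => ?_⟩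
  rw [pathWeight]
  exact Finset.prod_le_prod (fun _ _ => (h.boxLikelihood_pos _ _ _).le) fun _ _ => hB _ _ _

lemma continuous_pathWeight (h : IsObservedSystem P a b X y μ S σ) (t : ℕ) :
    Continuous fun p : (ℕ → Fin M → ℝ) × (ℕ → Fin N → ℝ) => pathWeight a b μ S σ p.1 p.2 t := by
  simp only [pathWeight]
  refine continuous_finsetProd _ fun i _ => ?_
  have hc : Continuous fun p : (ℕ → Fin M → ℝ) × (ℕ → Fin N → ℝ) => (p.1 (i + 1), p.2 i) :=
    ((continuous_apply (i + 1)).comp continuous_fst).prodMk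
      ((continuous_apply i).comp continuous_snd)
  exact (h.continuous_boxLikelihood i).comp hc

lemma continuous_pathWeight_path (h : IsObservedSystem P a b X y μ S σ) (z : ℕ → Fin N → ℝ)
    (t : ℕ) : Continuous fun x : ℕ → Fin M → ℝ => pathWeight a b μ S σ x z t :=
  Continuous.comp (f := fun x : ℕ → Fin M → ℝ => (x, z)) (h.continuous_pathWeight t)
    (continuous_id.prodMk continuous_const)

lemma continuous_pathWeight_obs (h : IsObservedSystem P a b X y μ S σ) (x : ℕ → Fin M → ℝ)
    (t : ℕ) : Continuous fun z : ℕ → Fin N → ℝ => pathWeight a b μ S σ x z t :=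
  Continuous.comp (f := fun z : ℕ → Fin N → ℝ => (x, z)) (h.continuous_pathWeight t)
    (continuous_const.prodMk continuous_id)

lemma measurable_pathWeight (h : IsObservedSystem P a b X y μ S σ) (z : ℕ → Fin N → ℝ) (t : ℕ) :
    Measurable fun ω => pathWeight a b μ S σ (fun s => X s ω) z t :=
  (h.continuous_pathWeight_path z t).measurable.comp (measurable_pi_lambda _ h.measurable_state)

lemma integrable_pathWeight [IsFiniteMeasure P] (h : IsObservedSystem P a b X y μ S σ)
    (z : ℕ → Fin N → ℝ) (t : ℕ) :
    Integrable (fun ω => pathWeight a b μ S σ (fun s => X s ω) z t) P := by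
  obtain ⟨B, hB⟩ := h.exists_pathWeight_le t
  refine Integrable.of_bound (h.measurable_pathWeight z t).aestronglyMeasurable B
    (Eventually.of_forall fun ω => ?_)
  rw [Real.norm_of_nonneg (h.pathWeight_pos (fun s => X s ω) z t).le]
  exact hB (fun s => X s ω) z

end IsObservedSystem

end Likelihood

/-- **Tonelli's theorem** for a product of functions of the coordinates. -/
lemma lintegral_fin_prod_eq_prod {n : ℕ} {E : Fin n → Type*} {mE : ∀ i, MeasurableSpace (E i)}
    {μ : (i : Fin n) → Measure (E i)} [∀ i, SigmaFinite (μ i)] (f : (i : Fin n) → E i → ℝ≥0∞)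
    (hf : ∀ i, Measurable (f i)) :
    ∫⁻ x : (i : Fin n) → E i, ∏ i, f i (x i) ∂(Measure.pi μ) = ∏ i, ∫⁻ x, f i x ∂(μ i) := by
  induction n with
  | zero => simp
  | succ n ih =>
    have hm : Measurable fun x : (i : Fin n) → E i.succ => ∏ i : Fin n, f i.succ (x i) :=
      Finset.measurable_prod _ fun i _ => (hf i.succ).comp (measurable_pi_apply i)
    calc
      _ = ∫⁻ x : E 0 × ((i : Fin n) → E i.succ), f 0 x.1 * ∏ i : Fin n, f i.succ (x.2 i)
            ∂((μ 0).prod (Measure.pi fun i => μ i.succ)) := by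
          refine Eq.trans (lintegral_congr fun x => ?_)
            ((measurePreserving_piFinSuccAbove μ 0).lintegral_comp
            (f := fun x => f 0 x.1 * ∏ i : Fin n, f i.succ (x.2 i))
            (((hf 0).comp measurable_fst).mul (hm.comp measurable_snd)))
          rw [Fin.prod_univ_succ]
          rfl
      _ = (∫⁻ x, f 0 x ∂μ 0) * ∏ i : Fin n, ∫⁻ x, f i.succ x ∂(μ i.succ) := by
          rw [lintegral_prod_mul (hf 0).aemeasurable hm.aemeasurable,
            ih (fun i => f i.succ) fun i => hf i.succ]
      _ = ∏ i, ∫⁻ x, f i x ∂(μ i) := by rw [Fin.prod_univ_succ]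

/-! ### Joint law of states and observations, and Bayes' formula. -/

section Bayes

variable {Ω : Type*} [MeasurableSpace Ω] {P : Measure Ω} {M N : ℕ} {a b : ℝ}
  {X : ℕ → Ω → Fin M → ℝ} {y : ℕ → Ω → Fin N → ℝ} {μ : ℕ → (Fin M → ℝ) → Fin N → ℝ}
  {S : ℕ → (Fin M → ℝ) → Matrix (Fin N) (Fin N) ℝ} {σ : ℝ}

/-- The extension of finitely many observations by zero. -/
def extendObs {t : ℕ} (w : Fin t → Fin N → ℝ) : ℕ → Fin N → ℝ :=
  fun i => if h : i < t then w ⟨i, h⟩ else 0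

lemma continuous_extendObs (t : ℕ) :
    Continuous (extendObs : (Fin t → Fin N → ℝ) → ℕ → Fin N → ℝ) := by
  refine continuous_pi fun i => ?_
  by_cases h : i < t
  · simpa [extendObs, h] using continuous_apply (⟨i, h⟩ : Fin t)
  · simpa [extendObs, h] using continuous_const

lemma pathWeight_extendObs (x : ℕ → Fin M → ℝ) (z : ℕ → Fin N → ℝ) (t : ℕ) :
    pathWeight a b μ S σ x (extendObs fun i : Fin t => z i) t = pathWeight a b μ S σ x z t := by
  simp only [pathWeight]
  exact Finset.prod_congr rfl fun i hi => by simp [extendObs, Finset.mem_range.1 hi]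

/-- The observations `y_0, …, y_{t-1}` as one random element. -/
def obsVector (y : ℕ → Ω → Fin N → ℝ) (t : ℕ) (ω : Ω) : Fin t → Fin N → ℝ := fun i => y i ω

namespace IsObservedSystem

lemma measurable_path (h : IsObservedSystem P a b X y μ S σ) :
    Measurable fun ω s => X s ω :=
  measurable_pi_lambda _ h.measurable_state

lemma measurable_obsVector (h : IsObservedSystem P a b X y μ S σ) (t : ℕ) :
    Measurable (obsVector y t) :=
  measurable_pi_lambda _ fun i => h.measurable_obs i

/-- The joint density of the observations `y_0, …, y_{t-1}`, given a state path, is measurable. -/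
lemma measurable_jointDensity (h : IsObservedSystem P a b X y μ S σ) (t : ℕ) :
    Measurable fun p : (ℕ → Fin M → ℝ) × (Fin t → Fin N → ℝ) =>
      ((√(2 * Real.pi) ^ N) ^ t)⁻¹ * pathWeight a b μ S σ p.1 (extendObs p.2) t :=
  (continuous_const.mul ((h.continuous_pathWeight t).comp
    (continuous_fst.prodMk ((continuous_extendObs t).comp continuous_snd)))).measurable

lemma jointDensity_eq_prod (x : ℕ → Fin M → ℝ) (t : ℕ)
    (w : Fin t → Fin N → ℝ) :
    ((√(2 * Real.pi) ^ N) ^ t)⁻¹ * pathWeight a b μ S σ x (extendObs w) t =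
      ∏ i : Fin t, gaussianDensity (μ i (clampBox a b (x (i + 1))))
        (obsCov S σ i (clampBox a b (x (i + 1)))) (w i) := by
  have hc : √(2 * Real.pi) ^ N ≠ 0 := by positivity
  rw [pathWeight, Finset.prod_range]
  simp only [boxLikelihood, likelihood, extendObs, Fin.is_lt, dite_true, Fin.eta]
  rw [Finset.prod_mul_distrib, Finset.prod_const, Finset.card_univ, Fintype.card_fin,
    inv_mul_cancel_left₀ (pow_ne_zero _ hc)]

/-- The joint law of the state path and the observations `y_0, …, y_t`. -/
lemma map_path_obsVector [IsProbabilityMeasure P] (h : IsObservedSystem P a b X y μ S σ) (t : ℕ) :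
    P.map (fun ω => ((fun s => X s ω), obsVector y (t + 1) ω)) =
      ((P.map fun ω s => X s ω).prod volume).withDensity fun p =>
        ENNReal.ofReal (((√(2 * Real.pi) ^ N) ^ (t + 1))⁻¹ *
          pathWeight a b μ S σ p.1 (extendObs p.2) (t + 1)) := by
  have hX := h.measurable_path
  have hJ : Measurable fun ω => ((fun s => X s ω), obsVector y (t + 1) ω) :=
    hX.prodMk (h.measurable_obsVector (t + 1))
  have hdens := (h.measurable_jointDensity (t + 1)).ennreal_ofReal
  have : IsProbabilityMeasure (P.map fun ω => ((fun s => X s ω), obsVector y (t + 1) ω)) :=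
    Measure.isProbabilityMeasure_map hJ.aemeasurable
  have : IsProbabilityMeasure (P.map fun ω s => X s ω) :=
    Measure.isProbabilityMeasure_map hX.aemeasurable
  have hrect : ∀ (A : Set (ℕ → Fin M → ℝ)) (B : Fin (t + 1) → Set (Fin N → ℝ)), MeasurableSet A →
      (∀ i, MeasurableSet (B i)) →
      P.map (fun ω => ((fun s => X s ω), obsVector y (t + 1) ω)) (A ×ˢ Set.univ.pi B) =
      ((P.map fun ω s => X s ω).prod volume).withDensity (fun p =>
        ENNReal.ofReal (((√(2 * Real.pi) ^ N) ^ (t + 1))⁻¹ *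
          pathWeight a b μ S σ p.1 (extendObs p.2) (t + 1))) (A ×ˢ Set.univ.pi B) := by
    intro A B hA hB
    have hBm : MeasurableSet (Set.univ.pi B) := MeasurableSet.univ_pi hB
    -- `obs_law` takes a sequence of sets; only its first `t + 1` terms matter.
    let B' : ℕ → Set (Fin N → ℝ) := fun i => if hi : i < t + 1 then B ⟨i, hi⟩ else Set.univ
    have hB' : ∀ i, MeasurableSet (B' i) := fun i => by
      simp only [B']
      split_ifs
      exacts [hB _, MeasurableSet.univ]
    have hBeq : ∀ i : Fin (t + 1), B' i = B i := fun i => dif_pos i.2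
    rw [Measure.map_apply hJ (hA.prod hBm), withDensity_apply _ (hA.prod hBm),
      setLIntegral_prod _ hdens.aemeasurable, setLIntegral_map hA
        (hdens.lintegral_prod_right' (ν := volume.restrict (Set.univ.pi B))) hX]
    have hset : (fun ω => ((fun s => X s ω), obsVector y (t + 1) ω)) ⁻¹' (A ×ˢ Set.univ.pi B) =
        {ω | (fun s => X s ω) ∈ A ∧ ∀ i ≤ t, y i ω ∈ B' i} := by
      ext ω
      simp only [Set.mem_preimage, Set.mem_prod, Set.mem_univ_pi, Set.mem_ofPred_eq, obsVector]
      refine and_congr_right fun _ => ⟨fun hω i hi => ?_, fun hω i => ?_⟩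
      · exact (hBeq ⟨i, Nat.lt_succ_of_le hi⟩).symm ▸ hω ⟨i, Nat.lt_succ_of_le hi⟩
      · rw [← hBeq]; exact hω i (Nat.lt_succ_iff.1 i.2)
    rw [hset, h.obs_law t A B' hA hB']
    refine lintegral_congr_ae (ae_restrict_of_ae ?_)
    -- Almost every path stays in the box, where the retraction is the identity; this removes the
    -- clamping.
    filter_upwards [ae_all_iff.2 h.mem_box] with ω hω
    simp only [jointDensity_eq_prod]
    have hpos : ∀ (w : Fin (t + 1) → Fin N → ℝ) (i : Fin (t + 1)), 0 ≤
        gaussianDensity (μ i (clampBox a b (X (i + 1) ω)))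
          (obsCov S σ i (clampBox a b (X (i + 1) ω))) (w i) := fun w i =>
      (h.gaussianDensity_pos i (clampBox_mem h.lt.le _) _).le
    simp_rw [ENNReal.ofReal_prod_of_nonneg fun i _ => hpos _ i]
    rw [show (volume : Measure (Fin (t + 1) → Fin N → ℝ)) = Measure.pi fun _ => volume from rfl,
      Measure.restrict_pi_pi, lintegral_fin_prod_eq_prod (fun (i : Fin (t + 1)) z =>
      ENNReal.ofReal (gaussianDensity (μ i (clampBox a b (X (i + 1) ω)))
          (obsCov S σ i (clampBox a b (X (i + 1) ω))) z)) fun i =>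
      (((h.continuous_gaussianDensity i).comp
        (continuous_const.prodMk continuous_id)).measurable).ennreal_ofReal, Finset.prod_range]
    refine Finset.prod_congr rfl fun i _ => ?_
    rw [hBeq, clampBox_eq (hω _)]
  -- Measurable rectangles form a generating π-system, and the total masses agree by the rectangle
  -- identity for the whole space.
  refine ext_of_generate_finite _ (generateFrom_eq_prod
    (MeasurableSpace.generateFrom_measurableSet (α := ℕ → Fin M → ℝ)) generateFrom_pi
    isCountablySpanning_measurableSet
    (IsCountablySpanning.pi fun _ => isCountablySpanning_measurableSet)).symm
    (MeasurableSpace.isPiSystem_measurableSet.prod isPiSystem_pi) ?_ ?_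
  · rintro _ ⟨A, hA, _, ⟨B, hB, rfl⟩, rfl⟩
    exact hrect A B hA fun i => hB i (Set.mem_univ i)
  · have := hrect Set.univ (fun _ => Set.univ) MeasurableSet.univ fun _ => MeasurableSet.univ
    simpa using this

variable {E : Type*} [NormedAddCommGroup E] [NormedSpace ℝ E]

/-- Expectations of functions of the state path and the observations `y_0, …, y_t`, computed by
integrating first over the state path. -/
lemma integral_path_obsVector [IsProbabilityMeasure P] (h : IsObservedSystem P a b X y μ S σ)
    (t : ℕ) {H : (ℕ → Fin M → ℝ) × (Fin (t + 1) → Fin N → ℝ) → E} (hH : StronglyMeasurable H)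
    (hint : Integrable (fun ω => H ((fun s => X s ω), obsVector y (t + 1) ω)) P) :
    ∫ ω, H ((fun s => X s ω), obsVector y (t + 1) ω) ∂P =
      ∫ w, ∫ x, (((√(2 * Real.pi) ^ N) ^ (t + 1))⁻¹ *
        pathWeight a b μ S σ x (extendObs w) (t + 1)) • H (x, w) ∂(P.map fun ω s => X s ω) := by
  have hX := h.measurable_path
  have hJ : Measurable fun ω => ((fun s => X s ω), obsVector y (t + 1) ω) :=
    hX.prodMk (h.measurable_obsVector (t + 1))
  have hdens := h.measurable_jointDensity (t + 1)
  have : IsProbabilityMeasure (P.map fun ω s => X s ω) :=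
    Measure.isProbabilityMeasure_map hX.aemeasurable
  have hnn : ∀ p : (ℕ → Fin M → ℝ) × (Fin (t + 1) → Fin N → ℝ),
      0 ≤ ((√(2 * Real.pi) ^ N) ^ (t + 1))⁻¹ *
        pathWeight a b μ S σ p.1 (extendObs p.2) (t + 1) := fun p => by
    have := h.pathWeight_pos p.1 (extendObs p.2) (t + 1)
    positivity
  have hint' : Integrable H (P.map fun ω => ((fun s => X s ω), obsVector y (t + 1) ω)) :=
    (integrable_map_measure hH.aestronglyMeasurable hJ.aemeasurable).2 hint
  rw [h.map_path_obsVector t, integrable_withDensity_iff_integrable_smul' hdens.ennreal_ofReal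
    (Eventually.of_forall fun _ => ENNReal.ofReal_lt_top)] at hint'
  have hmap := integral_map hJ.aemeasurable (hH.aestronglyMeasurable
    (μ := P.map fun ω => ((fun s => X s ω), obsVector y (t + 1) ω)))
  rw [← hmap, h.map_path_obsVector t, integral_withDensity_eq_integral_toReal_smul
    hdens.ennreal_ofReal (Eventually.of_forall fun _ => ENNReal.ofReal_lt_top),
    integral_prod_symm _ hint']
  simp_rw [fun x w => ENNReal.toReal_ofReal (hnn (x, w))]

omit [MeasurableSpace Ω] in
lemma measurable_obsVector_iSup (y : ℕ → Ω → Fin N → ℝ) (t : ℕ) :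
    Measurable[⨆ i ∈ Set.Iic t, MeasurableSpace.comap (y i) inferInstance]
      (obsVector y (t + 1)) := by
  refine @measurable_pi_lambda _ _ _ (_) _ _ fun i => ?_
  refine Measurable.mono (comap_measurable (y i)) ?_ le_rfl
  exact le_iSup₂_of_le (i : ℕ) (Nat.lt_succ_iff.1 i.2) le_rfl

/-- Every event of the complete history is almost surely equal to an event that is described by
the observations. -/
lemma exists_ae_eq_preimage_obsVector (y : ℕ → Ω → Fin N → ℝ) (t : ℕ) {s : Set Ω}
    (hs : MeasurableSet[completeHistory P y t] s) :
    ∃ D : Set (Fin (t + 1) → Fin N → ℝ), MeasurableSet D ∧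
      s =ᵐ[P] obsVector y (t + 1) ⁻¹' D := by
  -- The sets that are almost surely equal to an event of the observations form a σ-algebra, so it
  -- is enough to look at the generators: events of a single `y i`, and null events.
  have hle : completeHistory P y t ≤ eventuallyMeasurableSpace
      (MeasurableSpace.comap (obsVector y (t + 1)) inferInstance) (ae P) := by
    refine sup_le (iSup₂_le fun i hi => ?_) (MeasurableSpace.generateFrom_le fun u hu => ?_)
    · refine le_trans ?_ le_eventuallyMeasurableSpace
      rintro _ ⟨B, hB, rfl⟩
      exact ⟨(fun w : Fin (t + 1) → Fin N → ℝ => w ⟨i, Nat.lt_succ_of_le hi⟩) ⁻¹' B,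
        measurable_pi_apply _ hB, rfl⟩
    · exact ⟨∅, @MeasurableSet.empty _ (_), ae_eq_empty.2 hu.2⟩
  obtain ⟨_, ⟨D, hD, rfl⟩, hsD⟩ := hle s hs
  exact ⟨D, hD, hsD⟩

lemma completeHistory_le (h : IsObservedSystem P a b X y μ S σ) (t : ℕ) :
    completeHistory P y t ≤ ‹MeasurableSpace Ω› :=
  sup_le (iSup₂_le fun i _ => (h.measurable_obs i).comap_le)
    (MeasurableSpace.generateFrom_le fun _ hu => hu.1)

/-- The mean of a path functional, weighted with the likelihood of `z_0, …, z_{t-1}`. -/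
noncomputable def _root_.weightedMean (P : Measure Ω) (X : ℕ → Ω → Fin M → ℝ) (a b : ℝ)
    (μ : ℕ → (Fin M → ℝ) → Fin N → ℝ) (S : ℕ → (Fin M → ℝ) → Matrix (Fin N) (Fin N) ℝ) (σ : ℝ)
    (z : ℕ → Fin N → ℝ) (t : ℕ) (φ : (ℕ → Fin M → ℝ) → E) : E :=
  ∫ ω, pathWeight a b μ S σ (fun s => X s ω) z t • φ (fun s => X s ω) ∂P

lemma weightedMean_eq_integral_map (h : IsObservedSystem P a b X y μ S σ) (z : ℕ → Fin N → ℝ)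
    (t : ℕ) {φ : (ℕ → Fin M → ℝ) → E} (hφ : StronglyMeasurable φ) :
    weightedMean P X a b μ S σ z t φ =
      ∫ x, pathWeight a b μ S σ x z t • φ x ∂(P.map fun ω s => X s ω) :=
  (integral_map h.measurable_path.aemeasurable
    ((h.continuous_pathWeight_path z t).stronglyMeasurable.smul hφ).aestronglyMeasurable).symm

/-- Dominated convergence: the path weight is continuous in `z` and bounded uniformly in states and
observations. -/
lemma continuous_weightedMean [IsProbabilityMeasure P] (h : IsObservedSystem P a b X y μ S σ)
    (t : ℕ) {φ : (ℕ → Fin M → ℝ) → E} (hφ : StronglyMeasurable φ) {B : ℝ}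
    (hB : ∀ x, ‖φ x‖ ≤ B) :
    Continuous fun z => weightedMean P X a b μ S σ z t φ := by
  obtain ⟨B', hB'⟩ := h.exists_pathWeight_le t
  refine continuous_of_dominated (bound := fun _ => B' * B) (fun z => ?_)
    (fun z => Eventually.of_forall fun ω => ?_) (integrable_const _)
    (Eventually.of_forall fun ω =>
      (h.continuous_pathWeight_obs (fun s => X s ω) t).smul continuous_const)
  · exact (((h.continuous_pathWeight_path z t).stronglyMeasurable.smul hφ).comp_measurable
      h.measurable_path).aestronglyMeasurable
  · have h0 := (h.pathWeight_pos (fun s => X s ω) z t).le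
    have h1 := hB' (fun s => X s ω) z
    rw [norm_smul, Real.norm_of_nonneg h0]
    exact mul_le_mul h1 (hB _) (norm_nonneg _) (h0.trans h1)

/-- The path weight is positive everywhere. Therefore Bayes' quotient makes sense for every
observation path, not just for almost every one. -/
lemma weightedMean_one_pos [IsProbabilityMeasure P] (h : IsObservedSystem P a b X y μ S σ)
    (z : ℕ → Fin N → ℝ) (t : ℕ) :
    0 < weightedMean P X a b μ S σ z t (fun _ => (1 : ℝ)) := by
  have hpos : ∀ ω, 0 < pathWeight a b μ S σ (fun s => X s ω) z t := fun ω =>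
    h.pathWeight_pos (fun s => X s ω) z t
  simp only [weightedMean, smul_eq_mul, mul_one]
  rw [integral_pos_iff_support_of_nonneg (fun ω => (hpos ω).le) (h.integrable_pathWeight z t)]
  have : Function.support (fun ω => pathWeight a b μ S σ (fun s => X s ω) z t) = Set.univ :=
    Set.eq_univ_of_forall fun ω => (hpos ω).ne'
  simp [this]

/-- **Bayes' formula**: the optimal estimate of a path functional, as a function of the
observations. -/
noncomputable def _root_.bayesEstimate (P : Measure Ω) (X : ℕ → Ω → Fin M → ℝ) (a b : ℝ)
    (μ : ℕ → (Fin M → ℝ) → Fin N → ℝ) (S : ℕ → (Fin M → ℝ) → Matrix (Fin N) (Fin N) ℝ) (σ : ℝ)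
    (t : ℕ) (φ : (ℕ → Fin M → ℝ) → E) (z : ℕ → Fin N → ℝ) : E :=
  (weightedMean P X a b μ S σ z t (fun _ => (1 : ℝ)))⁻¹ • weightedMean P X a b μ S σ z t φ

/-- Continuity in `z` singles out a version of the conditional expectation for which a supremum over
all `ω` of an event can be controlled. -/
lemma continuous_bayesEstimate [IsProbabilityMeasure P] (h : IsObservedSystem P a b X y μ S σ)
    (t : ℕ) {φ : (ℕ → Fin M → ℝ) → E} (hφ : StronglyMeasurable φ) {B : ℝ}
    (hB : ∀ x, ‖φ x‖ ≤ B) : Continuous (bayesEstimate P X a b μ S σ t φ) :=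
  ((h.continuous_weightedMean t (stronglyMeasurable_const (b := (1 : ℝ))) (B := 1)
    (by simp)).inv₀ fun z => (h.weightedMean_one_pos z t).ne').smul
    (h.continuous_weightedMean t hφ hB)

/-- Only the first `t` observations enter, so the estimate factors through the finite vector
`obsVector y t`. -/
lemma bayesEstimate_extendObs (t : ℕ) (φ : (ℕ → Fin M → ℝ) → E) (z : ℕ → Fin N → ℝ) :
    bayesEstimate P X a b μ S σ t φ (extendObs fun i : Fin t => z i) =
      bayesEstimate P X a b μ S σ t φ z := by
  simp only [bayesEstimate, weightedMean, pathWeight_extendObs]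

lemma stronglyMeasurable_bayesEstimate [IsProbabilityMeasure P]
    (h : IsObservedSystem P a b X y μ S σ) (t : ℕ) {φ : (ℕ → Fin M → ℝ) → E}
    (hφ : StronglyMeasurable φ) {B : ℝ} (hB : ∀ x, ‖φ x‖ ≤ B) :
    StronglyMeasurable[completeHistory P y t]
      fun ω => bayesEstimate P X a b μ S σ (t + 1) φ (fun i => y i ω) := by
  have h1 : StronglyMeasurable fun w : Fin (t + 1) → Fin N → ℝ =>
      bayesEstimate P X a b μ S σ (t + 1) φ (extendObs w) :=
    ((h.continuous_bayesEstimate (t + 1) hφ hB).comp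
      (continuous_extendObs (t + 1))).stronglyMeasurable
  have h2 := h1.comp_measurable ((measurable_obsVector_iSup y t).mono
    (le_sup_left : _ ≤ completeHistory P y t) le_rfl)
  have heq : (fun ω => bayesEstimate P X a b μ S σ (t + 1) φ (fun i => y i ω)) =
      (fun w => bayesEstimate P X a b μ S σ (t + 1) φ (extendObs w)) ∘ obsVector y (t + 1) :=
    funext fun ω => (bayesEstimate_extendObs (t + 1) φ fun i => y i ω).symm
  rw [heq]
  exact h2

lemma norm_bayesEstimate_le [IsProbabilityMeasure P]
    (h : IsObservedSystem P a b X y μ S σ) (t : ℕ) {φ : (ℕ → Fin M → ℝ) → E} {B : ℝ}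
    (hB : ∀ x, ‖φ x‖ ≤ B) (z : ℕ → Fin N → ℝ) : ‖bayesEstimate P X a b μ S σ t φ z‖ ≤ B := by
  have hpos := h.weightedMean_one_pos z t
  rw [bayesEstimate, norm_smul, norm_inv, Real.norm_of_nonneg hpos.le, inv_mul_le_iff₀ hpos]
  have h0 : ∀ ω, 0 ≤ pathWeight a b μ S σ (fun s => X s ω) z t := fun ω =>
    (h.pathWeight_pos (fun s => X s ω) z t).le
  simp only [weightedMean, smul_eq_mul, mul_one]
  rw [← integral_mul_const]
  refine norm_integral_le_of_norm_le ((h.integrable_pathWeight z t).mul_const B)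
    (Eventually.of_forall fun ω => ?_)
  rw [norm_smul, Real.norm_of_nonneg (h0 ω)]
  exact mul_le_mul_of_nonneg_left (hB _) (h0 ω)

/-- Up to a null set, an event of the history is `{obsVector ∈ D}`. On it, the integrals of the
estimate and of `φ` are both computed with the joint density, states inside and observations
outside; the inner integrals already agree for each fixed observation vector. -/
lemma bayesEstimate_ae_eq_condExp [CompleteSpace E] [IsProbabilityMeasure P]
    (h : IsObservedSystem P a b X y μ S σ) (t : ℕ) {φ : (ℕ → Fin M → ℝ) → E}
    (hφ : StronglyMeasurable φ) {B : ℝ} (hB : ∀ x, ‖φ x‖ ≤ B) :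
    (fun ω => bayesEstimate P X a b μ S σ (t + 1) φ (fun i => y i ω)) =ᵐ[P]
      P[fun ω => φ (fun s => X s ω) | completeHistory P y t] := by
  have hX := h.measurable_path
  have hg := h.stronglyMeasurable_bayesEstimate t hφ hB
  have hgint : Integrable
      (fun ω => bayesEstimate P X a b μ S σ (t + 1) φ (fun i => y i ω)) P :=
    Integrable.of_bound (hg.mono (h.completeHistory_le t)).aestronglyMeasurable B
      (Eventually.of_forall fun ω => h.norm_bayesEstimate_le (t + 1) hB _)
  have hφint : Integrable (fun ω => φ (fun s => X s ω)) P :=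
    Integrable.of_bound (hφ.comp_measurable hX).aestronglyMeasurable B
      (Eventually.of_forall fun ω => hB _)
  refine ae_eq_condExp_of_forall_setIntegral_eq (h.completeHistory_le t) hφint
    (fun _ _ _ => hgint.integrableOn) (fun s hs _ => ?_) hg.aestronglyMeasurable
  obtain ⟨D, hD, hsD⟩ := exists_ae_eq_preimage_obsVector y t hs
  have hDm := h.measurable_obsVector (t + 1) hD
  have hF : StronglyMeasurable fun w : Fin (t + 1) → Fin N → ℝ =>
      bayesEstimate P X a b μ S σ (t + 1) φ (extendObs w) :=
    ((h.continuous_bayesEstimate (t + 1) hφ hB).comp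
      (continuous_extendObs (t + 1))).stronglyMeasurable
  have h1 := h.integral_path_obsVector t
    (H := fun p => (D.indicator fun w => bayesEstimate P X a b μ S σ (t + 1) φ (extendObs w)) p.2)
    ((hF.indicator hD).comp_measurable measurable_snd) (by
      refine (hgint.indicator hDm).congr (Eventually.of_forall fun ω => ?_)
      by_cases hω : obsVector y (t + 1) ω ∈ D
      · simp only [Set.indicator, Set.mem_preimage, hω, if_true]
        exact (bayesEstimate_extendObs (t + 1) φ fun i => y i ω).symm
      · simp only [Set.indicator, Set.mem_preimage, hω, if_false])
  have h2 := h.integral_path_obsVector t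
    (H := fun p => D.indicator (fun _ => φ p.1) p.2)
    (((hφ.comp_measurable measurable_fst).indicator (measurable_snd hD))) (by
      refine (hφint.indicator hDm).congr (Eventually.of_forall fun ω => ?_)
      rfl)
  rw [setIntegral_congr_set hsD, setIntegral_congr_set hsD, ← integral_indicator hDm,
    ← integral_indicator hDm]
  refine Eq.trans (Eq.trans (integral_congr_ae (Eventually.of_forall fun ω => ?_)) h1)
    (Eq.trans (integral_congr_ae (Eventually.of_forall fun w => ?_))
      (Eq.trans h2.symm (integral_congr_ae (Eventually.of_forall fun ω => rfl))))
  · by_cases hω : obsVector y (t + 1) ω ∈ D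
    · simp only [Set.indicator, Set.mem_preimage, hω, if_true]
      exact (bayesEstimate_extendObs (t + 1) φ fun i => y i ω).symm
    · simp only [Set.indicator, Set.mem_preimage, hω, if_false]
  · by_cases hw : w ∈ D
    -- For fixed `w` the estimate is constant in the path, so it leaves the inner integral and its
    -- denominator cancels against the total weight.
    · simp only [Set.indicator_of_mem hw, mul_smul]
      rw [integral_smul, integral_smul, integral_smul_const]
      congr 1
      have e1 := h.weightedMean_eq_integral_map (extendObs w) (t + 1)
        (stronglyMeasurable_const (b := (1 : ℝ)))
      simp only [smul_eq_mul, mul_one] at e1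
      rw [← e1, ← h.weightedMean_eq_integral_map (extendObs w) (t + 1) hφ, bayesEstimate,
        smul_inv_smul₀ (h.weightedMean_one_pos _ _).ne']
    · simp only [Set.indicator_of_notMem hw]

end IsObservedSystem

end Bayes

/-! ### Reduction to joint convergence of the unnormalized grid sums. -/

section Assembly

variable {Ω : Type*} [MeasurableSpace Ω] {P : Measure Ω} {M N : ℕ} {a b : ℝ}
  {X : ℕ → Ω → Fin M → ℝ} {y : ℕ → Ω → Fin N → ℝ} {μ : ℕ → (Fin M → ℝ) → Fin N → ℝ}
  {S : ℕ → (Fin M → ℝ) → Matrix (Fin N) (Fin N) ℝ} {σ : ℝ}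

/-- The observation path stays in a compact set with a probability arbitrarily close to `1`. -/
lemma IsObservedSystem.exists_isCompact_obs [IsProbabilityMeasure P]
    (h : IsObservedSystem P a b X y μ S σ) {ε : ℝ} (hε : 0 < ε) :
    ∃ K : Set (ℕ → Fin N → ℝ), IsCompact K ∧ MeasurableSet {ω | (fun i => y i ω) ∈ K} ∧
      1 - ε ≤ P.real {ω | (fun i => y i ω) ∈ K} := by
  have hy : Measurable fun ω i => y i ω := measurable_pi_lambda _ h.measurable_obs
  have : IsProbabilityMeasure (P.map fun ω i => y i ω) :=
    Measure.isProbabilityMeasure_map hy.aemeasurable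
  -- Ulam's theorem: a finite measure on a Polish space, here the sequence space, is tight.
  obtain ⟨K, hK, hKε⟩ := isTightMeasureSet_iff_exists_isCompact_measure_compl_le.1
    (isTightMeasureSet_singleton (μ := P.map fun ω i => y i ω)) (ENNReal.ofReal ε)
    (ENNReal.ofReal_pos.2 hε)
  have hKm : MeasurableSet {ω | (fun i => y i ω) ∈ K} := hy hK.measurableSet
  refine ⟨K, hK, hKm, ?_⟩
  have h1 := hKε _ rfl
  rw [Measure.map_apply hy hK.measurableSet.compl] at h1
  have h2 : P.real {ω | (fun i => y i ω) ∈ K}ᶜ ≤ ε :=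
    ENNReal.toReal_le_of_le_ofReal hε.le h1
  rw [measureReal_compl hKm, probReal_univ] at h2
  linarith

lemma gridRecursion_succ (X₀ : Ω → Fin M → ℝ) (n : ℕ)
    (A : Matrix (GridIndex M n) (GridIndex M n) ℝ) (z : ℕ → Fin N → ℝ) (t : ℕ)
    (l : GridIndex M n) :
    gridRecursion P a b μ S σ X₀ n A z (t + 1) l =
      likelihood μ S σ t (gridPoint a b n l) (z t) *
        A.mulVec (gridRecursion P a b μ S σ X₀ n A z t) l := by
  rw [gridRecursion, ← Matrix.mulVec_mulVec, Matrix.mulVec_diagonal]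

lemma IsObservedSystem.gridRecursion_nonneg (h : IsObservedSystem P a b X y μ S σ)
    (X₀ : Ω → Fin M → ℝ) (n : ℕ) {A : Matrix (GridIndex M n) (GridIndex M n) ℝ}
    (hA : ∀ i j, 0 ≤ A i j) (z : ℕ → Fin N → ℝ) (t : ℕ) (l : GridIndex M n) :
    0 ≤ gridRecursion P a b μ S σ X₀ n A z t l := by
  induction t generalizing l with
  | zero => exact measureReal_nonneg
  | succ t ih =>
    rw [gridRecursion_succ]
    exact mul_nonneg (h.likelihood_pos t (gridPoint_mem h.lt n l) _).le
      (Finset.sum_nonneg fun j _ => mul_nonneg (hA l j) (ih j))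

/-- The expectation of `φ` under the unnormalized grid based predictor with horizon `ρ`. -/
noncomputable def gridMean (P : Measure Ω) (a b : ℝ) (μ : ℕ → (Fin M → ℝ) → Fin N → ℝ)
    (S : ℕ → (Fin M → ℝ) → Matrix (Fin N) (Fin N) ℝ) (σ : ℝ) (X₀ : Ω → Fin M → ℝ) (n : ℕ)
    (A : Matrix (GridIndex M n) (GridIndex M n) ℝ) (z : ℕ → Fin N → ℝ) (t ρ : ℕ)
    (φ : (Fin M → ℝ) → ℝ) : ℝ :=
  ∑ l, φ (gridPoint a b n l) * (A ^ ρ).mulVec (gridRecursion P a b μ S σ X₀ n A z t) l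

/-- The entries are nonnegative, so the normalization is a grid sum too, and its limit comes from
the same convergence statement as that of the numerator. -/
lemma IsObservedSystem.l1_gridRecursion (h : IsObservedSystem P a b X y μ S σ)
    (X₀ : Ω → Fin M → ℝ) (n : ℕ) {A : Matrix (GridIndex M n) (GridIndex M n) ℝ}
    (hA : ∀ i j, 0 ≤ A i j) (z : ℕ → Fin N → ℝ) (t : ℕ) :
    l1 (gridRecursion P a b μ S σ X₀ n A z t) =
      gridMean P a b μ S σ X₀ n A z t 0 fun _ => 1 := by
  simp [l1, gridMean, abs_of_nonneg (h.gridRecursion_nonneg X₀ n hA z t _)]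

/-- Continuous convergence to `0` on a compact set is uniform. -/
lemma IsCompact.eventually_forall_le_of_tendsto {Y : Type*} [TopologicalSpace Y] {K : Set Y}
    (hK : IsCompact K) {D : ℕ → Y → ℝ≥0∞}
    (hD : ∀ z ∈ K, Tendsto (fun p : ℕ × Y => D p.1 p.2) (atTop ×ˢ 𝓝 z) (𝓝 0)) {ε : ℝ≥0∞}
    (hε : 0 < ε) : ∀ᶠ n in atTop, ∀ z ∈ K, D n z ≤ ε := by
  -- Each point of `K` has a neighbourhood with its own threshold in `n`; compactness leaves
  -- finitely many thresholds.
  have hmem := hK.mem_prod_nhdsSet_of_forall (l := (atTop : Filter ℕ))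
    (s := {p : ℕ × Y | D p.1 p.2 ≤ ε}) fun z hz => ENNReal.tendsto_nhds_zero.1 (hD z hz) ε hε
  obtain ⟨U, hU, V, hV, hUV⟩ := mem_prod_iff.1 hmem
  filter_upwards [hU] with n hn z hz
  exact hUV (Set.mk_mem_prod hn (subset_of_mem_nhdsSet hV hz))

/-- If the unnormalized grid based predictors converge weakly, jointly in the resolution and the
observations, then the grid based estimates converge. -/
theorem IsObservedSystem.gridEstimatesConverge [IsProbabilityMeasure P]
    (h : IsObservedSystem P a b X y μ S σ) {XL : ℕ → ℕ → Ω → Fin M → ℝ} (T : ℕ)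
    {K : Set (ℕ → Fin N → ℝ)} (hK : IsCompact K)
    (hex : ∀ n, ∃ A, IsTransitionMatrix P a b n (XL n) A)
    (hconv : ∀ A : ∀ n, Matrix (GridIndex M n) (GridIndex M n) ℝ,
      (∀ n, IsTransitionMatrix P a b n (XL n) (A n)) → ∀ (t ρ : ℕ) (φ : (Fin M → ℝ) → ℝ) (B : ℝ),
      Continuous φ → (∀ x, |φ x| ≤ B) → ∀ z₀ : ℕ → Fin N → ℝ,
      Tendsto (fun p : ℕ × (ℕ → Fin N → ℝ) => gridMean P a b μ S σ (X 0) p.1 (A p.1) p.2 t ρ φ)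
        (atTop ×ˢ 𝓝 z₀) (𝓝 (weightedMean P X a b μ S σ z₀ t fun x => φ (x (t + ρ))))) :
    GridEstimatesConverge P a b X y μ S σ XL T {ω | (fun i => y i ω) ∈ K} := by
  refine ⟨hex, fun A hA d φ hφc hφb ρ => ?_⟩
  -- Position `t + ρ + 1` of the path carries the state at time `t + ρ`.
  let ψ : ∀ t, (ℕ → Fin M → ℝ) → Fin (d (t + ρ)) → ℝ := fun t x => φ (t + ρ) (x (t + ρ + 1))
  have hψc : ∀ t, Continuous (ψ t) := fun t => (hφc (t + ρ)).comp (continuous_apply _)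
  have hψb : ∀ t, ∃ B, ∀ x, ‖ψ t x‖ ≤ B := fun t => by
    obtain ⟨B, hB⟩ := hφb (t + ρ)
    refine ⟨B, fun x => ?_⟩
    refine (pi_norm_le_iff_of_nonneg ((l1_nonneg _).trans (hB 0))).2 fun i => ?_
    exact (abs_le_l1 (ψ t x) i).trans (hB _)
  -- The Bayes version involves neither the matrices nor the resolution. Its index `t + 1` counts
  -- the observations `y_0, …, y_t`.
  refine ⟨fun t ω => bayesEstimate P X a b μ S σ (t + 1) (ψ t) (fun i => y i ω), fun t => ?_, ?_⟩
  · obtain ⟨B, hB⟩ := hψb t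
    exact ⟨h.stronglyMeasurable_bayesEstimate t (hψc t).stronglyMeasurable hB,
      h.bayesEstimate_ae_eq_condExp t (hψc t).stronglyMeasurable hB⟩
  have hlim : ∀ t, ∀ z₀ ∈ K, Tendsto (fun p : ℕ × (ℕ → Fin N → ℝ) => ENNReal.ofReal
      (l1 (gridEstimate P a b μ S σ (X 0) φ ρ p.1 (A p.1) p.2 t -
        bayesEstimate P X a b μ S σ (t + 1) (ψ t) p.2))) (atTop ×ˢ 𝓝 z₀) (𝓝 0) := by
    intro t z₀ _
    obtain ⟨B, hB⟩ := hψb t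
    -- The denominator is the case `φ = 1`, `ρ = 0`; its limit is positive, so quotients converge.
    have hden := hconv A hA (t + 1) 0 (fun _ => 1) 1 continuous_const (by simp) z₀
    have hden_pos := h.weightedMean_one_pos z₀ (t + 1)
    have hest : Tendsto (fun p : ℕ × (ℕ → Fin N → ℝ) =>
        gridEstimate P a b μ S σ (X 0) φ ρ p.1 (A p.1) p.2 t) (atTop ×ˢ 𝓝 z₀)
        (𝓝 (bayesEstimate P X a b μ S σ (t + 1) (ψ t) z₀)) := by
      rw [tendsto_pi_nhds]
      intro i
      have hnum := hconv A hA (t + 1) ρ (fun x => φ (t + ρ) x i) B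
        ((continuous_apply i).comp (hφc (t + ρ)))
        (fun x => (norm_le_pi_norm (φ (t + ρ) x) i).trans (hB fun _ => x)) z₀
      have hcomp : bayesEstimate P X a b μ S σ (t + 1) (ψ t) z₀ i =
          (weightedMean P X a b μ S σ z₀ (t + 1) fun _ => (1 : ℝ))⁻¹ *
            weightedMean P X a b μ S σ z₀ (t + 1) fun x => φ (t + ρ) (x (t + 1 + ρ)) i := by
        rw [bayesEstimate, Pi.smul_apply, smul_eq_mul, Nat.add_right_comm t 1 ρ]
        congr 1
        refine (ContinuousLinearMap.integral_comp_comm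
          (ContinuousLinearMap.proj (R := ℝ) (φ := fun _ : Fin (d (t + ρ)) => ℝ) i) ?_).symm
        refine Integrable.mono' ((h.integrable_pathWeight z₀ (t + 1)).mul_const B)
          ((h.measurable_pathWeight z₀ (t + 1)).aestronglyMeasurable.smul
            (((hψc t).stronglyMeasurable).comp_measurable h.measurable_path).aestronglyMeasurable)
          (Eventually.of_forall fun ω => ?_)
        have h0 := (h.pathWeight_pos (fun s => X s ω) z₀ (t + 1)).le
        rw [norm_smul, Real.norm_of_nonneg h0]
        exact mul_le_mul_of_nonneg_left (hB fun s => X s ω) h0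
      rw [hcomp]
      refine ((hden.inv₀ hden_pos.ne').mul hnum).congr fun p => ?_
      rw [← h.l1_gridRecursion (X 0) p.1 (hA p.1).nonneg p.2 (t + 1)]
      simp only [gridEstimate, gridMatrix, Matrix.mulVec_smul, Pi.smul_apply, smul_eq_mul]
      rfl
    have hbay := ((h.continuous_bayesEstimate (t + 1) (hψc t).stronglyMeasurable hB).tendsto
      z₀).comp (tendsto_snd (f := (atTop : Filter ℕ)) (g := 𝓝 z₀))
    have h0 := ENNReal.tendsto_ofReal
      ((continuous_l1 (ι := Fin (d (t + ρ)))).continuousAt.tendsto.comp (hest.sub hbay))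
    simpa [l1] using h0
  rw [ENNReal.tendsto_nhds_zero]
  intro ε hε
  have hev : ∀ t ∈ Set.Iic T, ∀ᶠ n in atTop, ∀ z ∈ K, ENNReal.ofReal
      (l1 (gridEstimate P a b μ S σ (X 0) φ ρ n (A n) z t -
        bayesEstimate P X a b μ S σ (t + 1) (ψ t) z)) ≤ ε := fun t _ =>
    hK.eventually_forall_le_of_tendsto (hlim t) hε
  filter_upwards [(Set.finite_Iic T).eventually_all.2 hev] with n hn
  exact iSup₂_le fun t ht => iSup₂_le fun ω hω => hn t ht _ hω

end Assembly

/-! ### Decomposition over the values of a finite random index, and a fact on independence. -/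

section Fibers

variable {Ω : Type*} [MeasurableSpace Ω] {P : Measure Ω}

lemma sum_mul_setIntegral_fiber {ι : Type*} [Fintype ι] {J : Ω → ι}
    (hJ : ∀ j, MeasurableSet {ω | J ω = j}) (c : ι → ℝ) {F : Ω → ℝ} (hF : Integrable F P) :
    ∑ j, c j * ∫ ω in {ω | J ω = j}, F ω ∂P = ∫ ω, c (J ω) * F ω ∂P := by
  have heq : ∀ j, ∀ ω ∈ {ω | J ω = j}, c j * F ω = c (J ω) * F ω := fun j ω hω => by
    rw [show J ω = j from hω]
  have hU : (⋃ j, {ω | J ω = j}) = Set.univ := Set.eq_univ_of_forall fun ω =>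
    Set.mem_iUnion.2 ⟨J ω, rfl⟩
  have hdisj : Pairwise (Function.onFun Disjoint fun j => {ω | J ω = j}) := fun i j hij =>
    Set.disjoint_left.2 fun ω hi hj => hij ((show J ω = i from hi).symm.trans hj)
  rw [← setIntegral_univ, ← hU, integral_iUnion_fintype hJ hdisj fun j =>
    ((hF.const_mul (c j)).integrableOn).congr_fun (heq j) (hJ j)]
  refine Finset.sum_congr rfl fun j _ => ?_
  rw [← integral_const_mul]
  exact setIntegral_congr_fun (hJ j) (heq j)

lemma sum_setIntegral_fiber {ι : Type*} [Fintype ι] {J : Ω → ι}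
    (hJ : ∀ j, MeasurableSet {ω | J ω = j}) {F : Ω → ℝ} (hF : Integrable F P) :
    ∑ j, ∫ ω in {ω | J ω = j}, F ω ∂P = ∫ ω, F ω ∂P := by
  simpa using sum_mul_setIntegral_fiber hJ (fun _ => 1) hF

lemma cond_real_eq {s : Set Ω} (hs : MeasurableSet s) (u : Set Ω) :
    (P[|s]).real u = (P.real s)⁻¹ * P.real (s ∩ u) := by
  simp [measureReal_def, cond_apply hs]

/-- The hypotheses make the joint law of the triple a product of three laws, which can be bracketed
the other way. -/
lemma indepFun_prodMk_of_indepFun_prodMk {α β γ : Type*} [MeasurableSpace α]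
    [MeasurableSpace β] [MeasurableSpace γ] [IsProbabilityMeasure P] {U : Ω → α} {V : Ω → β}
    {W : Ω → γ} (hU : Measurable U) (hV : Measurable V) (hW : Measurable W)
    (h : IndepFun U (fun ω => (V ω, W ω)) P) (hVW : IndepFun V W P) :
    IndepFun (fun ω => (U ω, V ω)) W P := by
  have hUV : IndepFun U V P := h.comp measurable_id measurable_fst
  have h1 := Measure.isProbabilityMeasure_map hU.aemeasurable (μ := P)
  have h2 := Measure.isProbabilityMeasure_map hV.aemeasurable (μ := P)
  have h3 := Measure.isProbabilityMeasure_map hW.aemeasurable (μ := P)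
  rw [indepFun_iff_map_prod_eq_prod_map_map hU.aemeasurable hV.aemeasurable] at hUV
  rw [indepFun_iff_map_prod_eq_prod_map_map hV.aemeasurable hW.aemeasurable] at hVW
  rw [indepFun_iff_map_prod_eq_prod_map_map hU.aemeasurable (hV.prodMk hW).aemeasurable, hVW] at h
  rw [indepFun_iff_map_prod_eq_prod_map_map (hU.prodMk hV).aemeasurable hW.aemeasurable, hUV]
  have e : (fun ω => ((U ω, V ω), W ω)) =
      (MeasurableEquiv.prodAssoc (α := α) (β := β) (γ := γ)).symm ∘
        fun ω => (U ω, V ω, W ω) := rfl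
  rw [e, ← Measure.map_map (MeasurableEquiv.measurable _) (hU.prodMk (hV.prodMk hW)), h,
    ← (measurePreserving_prodAssoc (P.map U) (P.map V) (P.map W)).map_eq,
    Measure.map_map (MeasurableEquiv.measurable _) (MeasurableEquiv.measurable _)]
  simp

end Fibers

/-! ### The Markovian quantization: exact representation and almost sure convergence. -/

section Markovian

variable {Ω : Type*} [MeasurableSpace Ω] {P : Measure Ω} {M N MW : ℕ} {a b : ℝ}
  {X : ℕ → Ω → Fin M → ℝ} {y : ℕ → Ω → Fin N → ℝ} {μ : ℕ → (Fin M → ℝ) → Fin N → ℝ}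
  {S : ℕ → (Fin M → ℝ) → Matrix (Fin N) (Fin N) ℝ} {σ : ℝ}
  {f : (Fin M → ℝ) → (Fin MW → ℝ) → (Fin M → ℝ)} {WS : Set (Fin MW → ℝ)}
  {W : ℕ → Ω → Fin MW → ℝ}

/-- The index of the cell occupied by the Markovian quantization. -/
noncomputable def markovianIndex (a b : ℝ) (f : (Fin M → ℝ) → (Fin MW → ℝ) → (Fin M → ℝ))
    (W : ℕ → Ω → Fin MW → ℝ) (X₀ : Ω → Fin M → ℝ) (n : ℕ) : ℕ → Ω → GridIndex M n
  | 0 => fun ω => cellIndex a b n (X₀ ω)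
  | t + 1 => fun ω => cellIndex a b n (f (markovianQuantization a b f W X₀ n t ω) (W t ω))

omit [MeasurableSpace Ω] in
lemma markovianQuantization_eq (X₀ : Ω → Fin M → ℝ) (n t : ℕ) (ω : Ω) :
    markovianQuantization a b f W X₀ n t ω =
      gridPoint a b n (markovianIndex a b f W X₀ n t ω) := by
  cases t <;> rfl

omit [MeasurableSpace Ω] in
lemma markovianQuantization_eq_gridPoint_iff (hab : a < b) (X₀ : Ω → Fin M → ℝ) (n t : ℕ) (ω : Ω)
    (l : GridIndex M n) :
    markovianQuantization a b f W X₀ n t ω = gridPoint a b n l ↔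
      markovianIndex a b f W X₀ n t ω = l := by
  rw [markovianQuantization_eq, (gridPoint_injective hab n).eq_iff]

/-- The initial state and the noise before time `t`. -/
def noiseHistory (X₀ : Ω → Fin M → ℝ) (W : ℕ → Ω → Fin MW → ℝ) (t : ℕ) (ω : Ω) :
    (Fin M → ℝ) × (Finset.range t → Fin MW → ℝ) :=
  (X₀ ω, fun i => W i ω)

namespace IsLipschitzModel

lemma measurable_noiseHistory (h : IsLipschitzModel P a b X f WS W) (hX : Measurable (X 0))
    (t : ℕ) : Measurable (noiseHistory (X 0) W t) :=
  hX.prodMk (measurable_pi_lambda _ fun i => h.measurable_noise i)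

/-- The initial state is independent of the whole noise, and the earlier noise is independent of `W
t`; regrouping the triple gives the joint statement. -/
lemma indepFun_noiseHistory [IsProbabilityMeasure P] (h : IsLipschitzModel P a b X f WS W)
    (hX : Measurable (X 0)) (t : ℕ) : IndepFun (noiseHistory (X 0) W t) (W t) P := by
  refine indepFun_prodMk_of_indepFun_prodMk hX
    (measurable_pi_lambda _ fun i => h.measurable_noise i) (h.measurable_noise t) ?_ ?_
  · exact h.indep_init.comp (ψ := fun w : ℕ → Fin MW → ℝ =>
      ((fun i : Finset.range t => w i), w t)) measurable_id
      ((measurable_pi_lambda _ fun i => measurable_pi_apply _).prodMk (measurable_pi_apply t))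
  · exact (h.indep_noise.indepFun_finset (Finset.range t) {t}
      (by simp) h.measurable_noise).comp
      (ψ := fun w : ({t} : Finset ℕ) → Fin MW → ℝ => w ⟨t, Finset.mem_singleton_self t⟩)
      measurable_id (measurable_pi_apply _)

/-- The quantized state at position `s` is built from the initial state and the noise before `s`.
Measurability for this small σ-algebra is what allows the independence of `W t` to be used. -/
lemma measurable_markovianQuantization_comap (h : IsLipschitzModel P a b X f WS W) (n : ℕ)
    {s t : ℕ} (hst : s ≤ t) :
    Measurable[MeasurableSpace.comap (noiseHistory (X 0) W t) inferInstance]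
      (markovianQuantization a b f W (X 0) n s) := by
  have hH : Measurable[MeasurableSpace.comap (noiseHistory (X 0) W t) inferInstance]
      (noiseHistory (X 0) W t) := comap_measurable _
  induction s with
  | zero => exact (measurable_quantizer n).comp (measurable_fst.comp hH)
  | succ s ih =>
    have hW : Measurable[MeasurableSpace.comap (noiseHistory (X 0) W t) inferInstance] (W s) :=
      (measurable_pi_apply (⟨s, Finset.mem_range.2 hst⟩ : Finset.range t)).comp
        (measurable_snd.comp hH)
    exact (measurable_quantizer n).comp
      (h.measurable_map.comp ((ih (Nat.le_of_succ_le hst)).prodMk hW))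

lemma measurableSet_markovianIndex_comap (h : IsLipschitzModel P a b X f WS W) (hab : a < b)
    (n : ℕ) {s t : ℕ} (hst : s ≤ t) (l : GridIndex M n) :
    MeasurableSet[MeasurableSpace.comap (noiseHistory (X 0) W t) inferInstance]
      {ω | markovianIndex a b f W (X 0) n s ω = l} := by
  simp only [← markovianQuantization_eq_gridPoint_iff hab]
  exact h.measurable_markovianQuantization_comap n hst (measurableSet_singleton _)

lemma measurableSet_markovianIndex (h : IsLipschitzModel P a b X f WS W) (hab : a < b)
    (hX : Measurable (X 0)) (n s : ℕ) (l : GridIndex M n) :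
    MeasurableSet {ω | markovianIndex a b f W (X 0) n s ω = l} :=
  (h.measurable_noiseHistory hX s).comap_le _ (h.measurableSet_markovianIndex_comap hab n le_rfl l)

/-- The Markov property of the Markovian quantization. -/
lemma setIntegral_markovianIndex [IsProbabilityMeasure P] (h : IsLipschitzModel P a b X f WS W)
    (hab : a < b) (hX : Measurable (X 0)) (n s : ℕ) (i j : GridIndex M n) {F : Ω → ℝ}
    (hF : Measurable[MeasurableSpace.comap (noiseHistory (X 0) W s) inferInstance] F) :
    ∫ ω in {ω | markovianIndex a b f W (X 0) n s ω = j} ∩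
        {ω | markovianIndex a b f W (X 0) n (s + 1) ω = i}, F ω ∂P =
      P.real {ω | cellIndex a b n (f (gridPoint a b n j) (W 0 ω)) = i} *
        ∫ ω in {ω | markovianIndex a b f W (X 0) n s ω = j}, F ω ∂P := by
  have hj := h.measurableSet_markovianIndex hab hX n s j
  have hi := h.measurableSet_markovianIndex hab hX n (s + 1) i
  let E : Set (Fin MW → ℝ) := {w | cellIndex a b n (f (gridPoint a b n j) w) = i}
  have hfj : Measurable fun w => f (gridPoint a b n j) w :=
    h.measurable_map.comp (measurable_const.prodMk measurable_id)
  have hE : MeasurableSet E :=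
    ((measurable_cellIndex n).comp hfj) (measurableSet_singleton i)
  let Fj : Ω → ℝ := {ω | markovianIndex a b f W (X 0) n s ω = j}.indicator F
  have hFj : Measurable[MeasurableSpace.comap (noiseHistory (X 0) W s) inferInstance] Fj :=
    Measurable.indicator hF (h.measurableSet_markovianIndex_comap hab n le_rfl j)
  let g : (Fin MW → ℝ) → ℝ := E.indicator fun _ => 1
  have hg : Measurable g := measurable_const.indicator hE
  have hle := (h.measurable_noiseHistory hX s).comap_le
  -- The past enters only through `Fj` and the transition out of the grid point `j` only through `W
  -- s`, so the expectation of the product factorizes.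
  have hind : IndepFun Fj (fun ω => g (W s ω)) P := by
    have h0 : Indep (MeasurableSpace.comap (noiseHistory (X 0) W s) inferInstance)
      (MeasurableSpace.comap (W s) inferInstance) P := h.indepFun_noiseHistory hX s
    refine indep_of_indep_of_le_right (indep_of_indep_of_le_left h0 hFj.comap_le) ?_
    exact (hg.comp (comap_measurable (W s))).comap_le
  have hmul := hind.integral_fun_mul_eq_mul_integral (hFj.mono hle le_rfl).aestronglyMeasurable
    (hg.comp (h.measurable_noise s)).aestronglyMeasurable
  -- Replacing `W s` by `W 0` makes the transition probabilities independent of time.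
  have hg_int : ∫ ω, g (W s ω) ∂P =
      P.real {ω | cellIndex a b n (f (gridPoint a b n j) (W 0 ω)) = i} := by
    have e := ((h.ident_noise s).comp hg).integral_eq
    refine e.trans ?_
    have : (g ∘ W 0) = (W 0 ⁻¹' E).indicator fun _ => 1 := rfl
    rw [this, integral_indicator_const _ (h.measurable_noise 0 hE), smul_eq_mul, mul_one]
    rfl
  rw [← integral_indicator (hj.inter hi), ← integral_indicator hj, mul_comm, ← hg_int]
  refine Eq.trans (integral_congr_ae (Eventually.of_forall fun ω => ?_)) hmul
  by_cases hω : markovianIndex a b f W (X 0) n s ω = j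
  · have hYj := (markovianQuantization_eq_gridPoint_iff hab (X 0) n s ω j).2 hω
    have hiff : markovianIndex a b f W (X 0) n (s + 1) ω = i ↔ W s ω ∈ E := by
      simp only [markovianIndex, hYj, E, Set.mem_ofPred_eq]
    by_cases hωi : W s ω ∈ E
    · simp [Fj, g, hω, hiff, hωi, Set.indicator]
    · simp [Fj, g, hω, hiff, hωi, Set.indicator]
  · simp [Fj, hω, Set.indicator]

lemma isTransitionMatrix [IsProbabilityMeasure P] (h : IsLipschitzModel P a b X f WS W)
    (hab : a < b) (hX : Measurable (X 0)) (n : ℕ) :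
    IsTransitionMatrix P a b n (markovianQuantization a b f W (X 0) n) (Matrix.of fun i j =>
      P.real {ω | cellIndex a b n (f (gridPoint a b n j) (W 0 ω)) = i}) where
  nonneg _ _ := measureReal_nonneg
  sum_col j := by
    have hfj : Measurable fun ω => cellIndex a b n (f (gridPoint a b n j) (W 0 ω)) :=
      (measurable_cellIndex n).comp
        (h.measurable_map.comp (measurable_const.prodMk (h.measurable_noise 0)))
    have := sum_setIntegral_fiber (P := P) (fun i => hfj (measurableSet_singleton i))
      (integrable_const (1 : ℝ))
    simpa using this
  eq_cond t i j hne := by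
    have hj := h.measurableSet_markovianIndex hab hX n t j
    have := h.setIntegral_markovianIndex hab hX n t i j (F := fun _ => 1) measurable_const
    simp only [markovianQuantization_eq_gridPoint_iff hab] at hne ⊢
    simp only [integral_const, smul_eq_mul, mul_one, measureReal_restrict_apply_univ] at this
    rw [cond_real_eq hj, this, Matrix.of_apply, mul_left_comm, inv_mul_cancel₀, mul_one]
    exact (measureReal_ne_zero_iff).2 hne

/-- The Markov property with a weight `F` from the past, summed over the current cell. Arbitrary
columns of the matrix are harmless: they meet integrals over null events. -/
lemma transitionMatrix_mulVec [IsProbabilityMeasure P] (h : IsLipschitzModel P a b X f WS W)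
    (hab : a < b) (hX : Measurable (X 0)) {n : ℕ} {A : Matrix (GridIndex M n) (GridIndex M n) ℝ}
    (hA : IsTransitionMatrix P a b n (markovianQuantization a b f W (X 0) n) A) (s : ℕ)
    {F : Ω → ℝ} (hF : Measurable[MeasurableSpace.comap (noiseHistory (X 0) W s) inferInstance] F)
    (hint : Integrable F P) (i : GridIndex M n) :
    A.mulVec (fun j => ∫ ω in {ω | markovianIndex a b f W (X 0) n s ω = j}, F ω ∂P) i =
      ∫ ω in {ω | markovianIndex a b f W (X 0) n (s + 1) ω = i}, F ω ∂P := by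
  have hj := h.measurableSet_markovianIndex hab hX n s
  rw [← sum_setIntegral_fiber hj hint.integrableOn]
  refine Finset.sum_congr rfl fun j _ => ?_
  change A i j * (∫ ω in {ω | markovianIndex a b f W (X 0) n s ω = j}, F ω ∂P) = _
  rw [Measure.restrict_restrict (hj j), h.setIntegral_markovianIndex hab hX n s i j hF]
  by_cases hne : P {ω | markovianIndex a b f W (X 0) n s ω = j} = 0
  · rw [setIntegral_measure_zero _ hne, mul_zero, mul_zero]
  · congr 1
    have hne' : P {ω | markovianQuantization a b f W (X 0) n s ω = gridPoint a b n j} ≠ 0 := by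
      simpa only [markovianQuantization_eq_gridPoint_iff hab] using hne
    rw [hA.eq_cond s i j hne',
      ← (h.isTransitionMatrix hab hX n).eq_cond s i j hne',
      Matrix.of_apply]

/-- Induction on the time along a fixed `ω`: `f` is continuous in the state on the box, where the
quantized states live, and each step adds an error of at most one cell width per coordinate. -/
lemma tendsto_markovianQuantization (h : IsLipschitzModel P a b X f WS W) (hab : a < b)
    (hbox : ∀ s, ∀ᵐ ω ∂P, X s ω ∈ stateBox M a b) :
    ∀ᵐ ω ∂P, ∀ s, Tendsto (fun n => markovianQuantization a b f W (X 0) n s ω) atTop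
      (𝓝 (X s ω)) := by
  obtain ⟨K, Ksup, hK⟩ := h.lipschitz
  filter_upwards [ae_all_iff.2 hbox, ae_all_iff.2 h.mem_noise, ae_all_iff.2 h.state_eq]
    with ω hω hW hX s
  induction s with
  | zero => exact tendsto_quantizer hab (hω 0)
  | succ s ih =>
    have hY : ∀ n, markovianQuantization a b f W (X 0) n s ω ∈ stateBox M a b := fun n => by
      rw [markovianQuantization_eq]
      exact gridPoint_mem hab n _
    rw [hX s, tendsto_pi_nhds]
    intro m
    have hf : ContinuousOn (fun x => f x (W s ω) m) (stateBox M a b) :=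
      continuousOn_of_l1_lipschitz fun x hx x' hx' =>
        (abs_le_l1 (f x (W s ω) - f x' (W s ω)) m).trans ((hK _ (hW s)).2.2 x hx x' hx')
    have h1 : Tendsto (fun n => f (markovianQuantization a b f W (X 0) n s ω) (W s ω) m) atTop
        (𝓝 (f (X s ω) (W s ω) m)) :=
      (hf _ (hω s)).tendsto.comp (tendsto_nhdsWithin_iff.2 ⟨ih, Eventually.of_forall hY⟩)
    have h2 : Tendsto (fun n => markovianQuantization a b f W (X 0) n (s + 1) ω m -
        f (markovianQuantization a b f W (X 0) n s ω) (W s ω) m) atTop (𝓝 0) :=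
      squeeze_zero_norm (fun n => abs_quantizer_sub_le hab n (h.maps_box _ (hY n) _ (hW s)) m)
        (tendsto_cellWidth a b)
    simpa using h2.add h1

lemma measurable_pathWeight_markovianQuantization (h : IsLipschitzModel P a b X f WS W)
    (hsys : IsObservedSystem P a b X y μ S σ) (n : ℕ) (z : ℕ → Fin N → ℝ) {t r : ℕ}
    (htr : t ≤ r) :
    Measurable[MeasurableSpace.comap (noiseHistory (X 0) W r) inferInstance] fun ω =>
      pathWeight a b μ S σ (fun s => markovianQuantization a b f W (X 0) n s ω) z t := by
  simp only [pathWeight]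
  refine Finset.measurable_prod _ fun i hi => ?_
  have hc : Continuous fun x : Fin M → ℝ => boxLikelihood a b μ S σ i x (z i) :=
    Continuous.comp (f := fun x : Fin M → ℝ => (x, z i)) (hsys.continuous_boxLikelihood i)
      (continuous_id.prodMk continuous_const)
  exact hc.measurable.comp (h.measurable_markovianQuantization_comap n
    (Nat.succ_le_of_lt ((Finset.mem_range.1 hi).trans_le htr)))

lemma integrable_pathWeight_markovianQuantization [IsProbabilityMeasure P]
    (h : IsLipschitzModel P a b X f WS W) (hsys : IsObservedSystem P a b X y μ S σ) (n : ℕ)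
    (z : ℕ → Fin N → ℝ) (t : ℕ) :
    Integrable (fun ω =>
      pathWeight a b μ S σ (fun s => markovianQuantization a b f W (X 0) n s ω) z t) P := by
  obtain ⟨B, hB⟩ := hsys.exists_pathWeight_le t
  refine Integrable.of_bound ((h.measurable_pathWeight_markovianQuantization hsys n z
    le_rfl).mono (h.measurable_noiseHistory (hsys.measurable_state 0) t).comap_le
    le_rfl).aestronglyMeasurable B (Eventually.of_forall fun ω => ?_)
  rw [Real.norm_of_nonneg (hsys.pathWeight_pos _ _ _).le]
  exact hB _ _

/-- The unnormalized grid based filter is the weighted law of the Markovian quantization. -/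
lemma gridRecursion_eq [IsProbabilityMeasure P] (h : IsLipschitzModel P a b X f WS W)
    (hsys : IsObservedSystem P a b X y μ S σ) {n : ℕ}
    {A : Matrix (GridIndex M n) (GridIndex M n) ℝ}
    (hA : IsTransitionMatrix P a b n (markovianQuantization a b f W (X 0) n) A)
    (z : ℕ → Fin N → ℝ) (t : ℕ) :
    gridRecursion P a b μ S σ (X 0) n A z t = fun l =>
      ∫ ω in {ω | markovianIndex a b f W (X 0) n t ω = l}, pathWeight a b μ S σ
        (fun s => markovianQuantization a b f W (X 0) n s ω) z t ∂P := by
  have hX := hsys.measurable_state 0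
  induction t with
  | zero =>
    funext l
    simp [gridRecursion, pathWeight, quantizer_eq_gridPoint_iff hsys.lt, markovianIndex]
  | succ t ih =>
    funext l
    rw [gridRecursion_succ, ih, h.transitionMatrix_mulVec hsys.lt hX hA t
      (h.measurable_pathWeight_markovianQuantization hsys n z le_rfl)
      (h.integrable_pathWeight_markovianQuantization hsys n z t), ← integral_const_mul]
    refine setIntegral_congr_fun (h.measurableSet_markovianIndex hsys.lt hX n (t + 1) l)
      fun ω hω => ?_
    rw [pathWeight_succ, (markovianQuantization_eq_gridPoint_iff hsys.lt (X 0) n (t + 1) ω l).2 hω,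
      boxLikelihood_eq (gridPoint_mem hsys.lt n l), mul_comm]

lemma pow_mulVec_gridRecursion_eq [IsProbabilityMeasure P] (h : IsLipschitzModel P a b X f WS W)
    (hsys : IsObservedSystem P a b X y μ S σ) {n : ℕ}
    {A : Matrix (GridIndex M n) (GridIndex M n) ℝ}
    (hA : IsTransitionMatrix P a b n (markovianQuantization a b f W (X 0) n) A)
    (z : ℕ → Fin N → ℝ) (t ρ : ℕ) :
    (A ^ ρ).mulVec (gridRecursion P a b μ S σ (X 0) n A z t) = fun l =>
      ∫ ω in {ω | markovianIndex a b f W (X 0) n (t + ρ) ω = l}, pathWeight a b μ S σ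
        (fun s => markovianQuantization a b f W (X 0) n s ω) z t ∂P := by
  induction ρ with
  | zero => simpa using h.gridRecursion_eq hsys hA z t
  | succ ρ ih =>
    funext l
    rw [pow_succ', ← Matrix.mulVec_mulVec, ih, h.transitionMatrix_mulVec hsys.lt
      (hsys.measurable_state 0) hA (t + ρ)
      (h.measurable_pathWeight_markovianQuantization hsys n z (Nat.le_add_right t ρ))
      (h.integrable_pathWeight_markovianQuantization hsys n z t)]
    rfl

/-- The recursion is the exact unnormalized filter for a model whose hidden state is the quantized
chain. The only approximation left is that of the state path. -/
lemma gridMean_eq [IsProbabilityMeasure P] (h : IsLipschitzModel P a b X f WS W)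
    (hsys : IsObservedSystem P a b X y μ S σ) {n : ℕ}
    {A : Matrix (GridIndex M n) (GridIndex M n) ℝ}
    (hA : IsTransitionMatrix P a b n (markovianQuantization a b f W (X 0) n) A)
    (z : ℕ → Fin N → ℝ) (t ρ : ℕ) (φ : (Fin M → ℝ) → ℝ) :
    gridMean P a b μ S σ (X 0) n A z t ρ φ =
      weightedMean P (markovianQuantization a b f W (X 0) n) a b μ S σ z t
        fun x => φ (x (t + ρ)) := by
  rw [gridMean, h.pow_mulVec_gridRecursion_eq hsys hA z t ρ, sum_mul_setIntegral_fiber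
    (h.measurableSet_markovianIndex hsys.lt (hsys.measurable_state 0) n (t + ρ))
    (fun l => φ (gridPoint a b n l)) (h.integrable_pathWeight_markovianQuantization hsys n z t)]
  refine integral_congr_ae (Eventually.of_forall fun ω => ?_)
  simp only [smul_eq_mul]
  rw [mul_comm, markovianQuantization_eq (X 0) n (t + ρ)]

/-- Dominated convergence along the product filter: the path weight is jointly continuous in states
and observations, and the quantized path converges almost surely. -/
lemma tendsto_gridMean [IsProbabilityMeasure P] (h : IsLipschitzModel P a b X f WS W)
    (hsys : IsObservedSystem P a b X y μ S σ)
    {A : ∀ n, Matrix (GridIndex M n) (GridIndex M n) ℝ}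
    (hA : ∀ n, IsTransitionMatrix P a b n (markovianQuantization a b f W (X 0) n) (A n))
    (t ρ : ℕ) {φ : (Fin M → ℝ) → ℝ} {B : ℝ} (hφ : Continuous φ) (hB : ∀ x, |φ x| ≤ B)
    (z₀ : ℕ → Fin N → ℝ) :
    Tendsto (fun p : ℕ × (ℕ → Fin N → ℝ) => gridMean P a b μ S σ (X 0) p.1 (A p.1) p.2 t ρ φ)
      (atTop ×ˢ 𝓝 z₀) (𝓝 (weightedMean P X a b μ S σ z₀ t fun x => φ (x (t + ρ)))) := by
  obtain ⟨B', hB'⟩ := hsys.exists_pathWeight_le t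
  have hX := hsys.measurable_state 0
  simp only [h.gridMean_eq hsys (hA _)]
  refine tendsto_integral_filter_of_dominated_convergence (fun _ => B' * B)
    (Eventually.of_forall fun p => ?_)
    (Eventually.of_forall fun p => Eventually.of_forall fun ω => ?_) (integrable_const _) ?_
  · refine (h.integrable_pathWeight_markovianQuantization hsys p.1 p.2
      t).aestronglyMeasurable.smul (Measurable.aestronglyMeasurable ?_)
    exact hφ.measurable.comp ((h.measurable_markovianQuantization_comap p.1 le_rfl).mono
      (h.measurable_noiseHistory hX (t + ρ)).comap_le le_rfl)
  · have h0 := (hsys.pathWeight_pos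
      (fun s => markovianQuantization a b f W (X 0) p.1 s ω) p.2 t).le
    have h1 := hB' (fun s => markovianQuantization a b f W (X 0) p.1 s ω) p.2
    rw [norm_smul, Real.norm_of_nonneg h0]
    exact mul_le_mul h1 (hB _) (norm_nonneg _) (h0.trans h1)
  · filter_upwards [h.tendsto_markovianQuantization hsys.lt hsys.mem_box] with ω hω
    have h1 : Tendsto (fun p : ℕ × (ℕ → Fin N → ℝ) => fun s =>
        markovianQuantization a b f W (X 0) p.1 s ω) (atTop ×ˢ 𝓝 z₀) (𝓝 fun s => X s ω) :=
      tendsto_pi_nhds.2 fun s => (hω s).comp tendsto_fst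
    have h2 := ((hsys.continuous_pathWeight t).tendsto ((fun s => X s ω), z₀)).comp
      (h1.prodMk_nhds tendsto_snd)
    exact h2.smul ((hφ.tendsto _).comp ((hω (t + ρ)).comp tendsto_fst))

/-- Convergence of the grid based estimates for the Markovian quantization. -/
theorem gridEstimatesConverge [IsProbabilityMeasure P] (h : IsLipschitzModel P a b X f WS W)
    (hsys : IsObservedSystem P a b X y μ S σ) (T : ℕ) {K : Set (ℕ → Fin N → ℝ)}
    (hK : IsCompact K) :
    GridEstimatesConverge P a b X y μ S σ (markovianQuantization a b f W (X 0)) T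
      {ω | (fun i => y i ω) ∈ K} :=
  hsys.gridEstimatesConverge T hK
    (fun n => ⟨_, h.isTransitionMatrix hsys.lt (hsys.measurable_state 0) n⟩)
    fun _ hA t ρ _ _ hφ hB z₀ => h.tendsto_gridMean hsys hA t ρ hφ hB z₀

end IsLipschitzModel

end Markovian

/-! ### Convergence of cell averages in `L¹`. -/

section CellAverages

variable {M : ℕ} {a b : ℝ} {ν : Measure (Fin M → ℝ)}

lemma measurableSet_cellIndex_eq (a b : ℝ) (n : ℕ) (l : GridIndex M n) :
    MeasurableSet {x : Fin M → ℝ | cellIndex a b n x = l} :=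
  measurable_cellIndex n (measurableSet_singleton l)

lemma integrable_comp_cellIndex [IsFiniteMeasure ν] (n : ℕ) (c : GridIndex M n → ℝ) :
    Integrable (fun x => c (cellIndex a b n x)) ν := by
  refine Integrable.of_bound
    ((measurable_of_countable c).comp (measurable_cellIndex n)).aestronglyMeasurable
    (∑ j, |c j|) (Eventually.of_forall fun x => ?_)
  exact abs_le_l1 c _

lemma integral_abs_sub_triangle {f g h : (Fin M → ℝ) → ℝ} (hf : Integrable f ν)
    (hg : Integrable g ν) (hh : Integrable h ν) :
    ∫ x, |f x - h x| ∂ν ≤ ∫ x, |f x - g x| ∂ν + ∫ x, |g x - h x| ∂ν :=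
  (integral_mono (hf.sub hh).abs ((hf.sub hg).abs.add (hg.sub hh).abs) fun x =>
    abs_sub_le (f x) (g x) (h x)).trans_eq (integral_add (hf.sub hg).abs (hg.sub hh).abs)

/-- Quantization of the argument does not change a bounded continuous function in the limit. -/
lemma tendsto_integral_abs_quantizer_sub [IsFiniteMeasure ν] (hab : a < b)
    (hν : ∀ᵐ x ∂ν, x ∈ stateBox M a b) {φ : (Fin M → ℝ) → ℝ} (hφ : Continuous φ) {B : ℝ}
    (hB : ∀ x, |φ x| ≤ B) :
    Tendsto (fun n => ∫ x, |φ (quantizer a b n x) - φ x| ∂ν) atTop (𝓝 0) := by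
  have h0 : ∫ _, (0 : ℝ) ∂ν = 0 := integral_zero _ _
  rw [← h0]
  refine tendsto_integral_of_dominated_convergence (fun _ => B + B) (fun n => ?_)
    (integrable_const _) (fun n => Eventually.of_forall fun x => ?_) ?_
  · exact ((hφ.measurable.comp (measurable_quantizer n)).sub hφ.measurable).abs.aestronglyMeasurable
  · rw [Real.norm_eq_abs, abs_abs]
    exact (abs_sub _ _).trans (add_le_add (hB _) (hB _))
  · filter_upwards [hν] with x hx
    have := (((hφ.tendsto x).comp (tendsto_quantizer hab hx)).sub_const (φ x)).abs
    simpa using this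

/-- A function that has the same cell averages as `g'` approximates `g` in mean, if `g'` does and
if `g` is well approximated by a function `φ` that varies little over the cells. -/
lemma integral_abs_cell_sub_le [IsFiniteMeasure ν] (n : ℕ) {c : GridIndex M n → ℝ}
    {g g' φ : (Fin M → ℝ) → ℝ} (hg : Integrable g ν) (hg' : Integrable g' ν) (hφ : Integrable φ ν)
    (hc : ∀ j, c j * ν.real {x | cellIndex a b n x = j} =
      ∫ x in {x | cellIndex a b n x = j}, g' x ∂ν) :
    ∫ x, |c (cellIndex a b n x) - g x| ∂ν ≤ ∫ x, |g' x - g x| ∂ν +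
      2 * ∫ x, |g x - φ x| ∂ν + 2 * ∫ x, |φ (quantizer a b n x) - φ x| ∂ν := by
  have hQ : Integrable (fun x => φ (quantizer a b n x)) ν :=
    integrable_comp_cellIndex n fun l => φ (gridPoint a b n l)
  have hcQ : Integrable (fun x => c (cellIndex a b n x)) ν := integrable_comp_cellIndex n c
  have hfib := measurableSet_cellIndex_eq (M := M) a b n
  -- On a cell, `c - φ ∘ quantizer` is constant and, if the cell is not null, equals the mean of `g'
  -- - φ ∘ quantizer` there; averaging does not increase the `L¹` norm.
  have h1 : ∫ x, |c (cellIndex a b n x) - φ (quantizer a b n x)| ∂ν ≤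
      ∫ x, |g' x - φ (quantizer a b n x)| ∂ν := by
    have e := sum_mul_setIntegral_fiber (P := ν) hfib (fun j => |c j - φ (gridPoint a b n j)|)
      (integrable_const (1 : ℝ))
    simp only [mul_one] at e
    have e' := sum_setIntegral_fiber (P := ν) hfib
      (F := fun x => |g' x - φ (quantizer a b n x)|) (hg'.sub hQ).abs
    rw [show (fun x => |c (cellIndex a b n x) - φ (quantizer a b n x)|) = fun x =>
      |c (cellIndex a b n x) - φ (gridPoint a b n (cellIndex a b n x))| from rfl, ← e, ← e']
    refine Finset.sum_le_sum fun j _ => ?_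
    have e1 : ∫ x in {x | cellIndex a b n x = j}, (g' x - φ (quantizer a b n x)) ∂ν =
        (c j - φ (gridPoint a b n j)) * ν.real {x | cellIndex a b n x = j} := by
      rw [integral_sub hg'.integrableOn hQ.integrableOn, ← hc j, sub_mul]
      congr 1
      rw [setIntegral_congr_fun (g := fun _ => φ (gridPoint a b n j)) (hfib j) fun x hx => by
        simp only [quantizer, show cellIndex a b n x = j from hx]]
      simp [mul_comm]
    have e2 : |c j - φ (gridPoint a b n j)| * ∫ _ in {x | cellIndex a b n x = j}, (1 : ℝ) ∂ν =
        |∫ x in {x | cellIndex a b n x = j}, (g' x - φ (quantizer a b n x)) ∂ν| := by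
      rw [e1, abs_mul, abs_of_nonneg (measureReal_nonneg (μ := ν))]
      simp
    rw [e2]
    exact abs_integral_le_integral_abs
  -- The detour from `g` through `φ` to `φ ∘ quantizer` is made twice, once to compare with `g'` and
  -- once with `c`; hence the factors 2.
  have h2 := integral_abs_sub_triangle hg' hg hQ
  have h3 := integral_abs_sub_triangle hg hφ hQ
  have h4 := integral_abs_sub_triangle hcQ hQ hg
  have h5 := integral_abs_sub_triangle hQ hφ hg
  simp only [abs_sub_comm (φ _) (φ (quantizer a b n _))] at h3
  simp only [abs_sub_comm (φ _) (g _)] at h4 h5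
  linarith

/-- Cell averages of functions that converge in mean converge in mean, to the same limit. -/
lemma tendsto_integral_abs_cell_sub [IsFiniteMeasure ν] (hab : a < b)
    (hν : ∀ᵐ x ∂ν, x ∈ stateBox M a b) {ι : Type*} {𝓕 : Filter ι} {u : ι → ℕ}
    (hu : Tendsto u 𝓕 atTop) {c : ∀ i, GridIndex M (u i) → ℝ} {g : (Fin M → ℝ) → ℝ}
    {g' : ι → (Fin M → ℝ) → ℝ} (hg : Integrable g ν) (hg' : ∀ i, Integrable (g' i) ν)
    (hc : ∀ i j, c i j * ν.real {x | cellIndex a b (u i) x = j} =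
      ∫ x in {x | cellIndex a b (u i) x = j}, g' i x ∂ν)
    (hlim : Tendsto (fun i => ∫ x, |g' i x - g x| ∂ν) 𝓕 (𝓝 0)) :
    Tendsto (fun i => ∫ x, |c i (cellIndex a b (u i) x) - g x| ∂ν) 𝓕 (𝓝 0) := by
  rw [Metric.tendsto_nhds]
  intro ε hε
  -- `g` need not be continuous. An `L¹` error of at most `ε / 4`, counted twice, stays below `ε`.
  obtain ⟨φ, hφε, hφ⟩ := hg.exists_boundedContinuous_integral_sub_le (half_pos (half_pos hε))
  have h1 : Tendsto (fun i => ∫ x, |g' i x - g x| ∂ν + 2 * ∫ x, |g x - φ x| ∂ν +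
      2 * ∫ x, |φ (quantizer a b (u i) x) - φ x| ∂ν) 𝓕
      (𝓝 (0 + 2 * ∫ x, |g x - φ x| ∂ν + 2 * 0)) :=
    (hlim.add_const _).add (((tendsto_integral_abs_quantizer_sub hab hν φ.continuous
      φ.norm_coe_le_norm).comp hu).const_mul 2)
  have h2 : 0 + 2 * ∫ x, |g x - φ x| ∂ν + 2 * 0 < ε := by
    have : ∫ x, |g x - φ x| ∂ν ≤ ε / 2 / 2 := hφε
    linarith
  filter_upwards [h1.eventually_lt_const h2] with i hi
  rw [Real.dist_0_eq_abs, abs_of_nonneg (integral_nonneg fun _ => abs_nonneg _)]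
  exact (integral_abs_cell_sub_le (u i) hg (hg' i) hφ (hc i)).trans_lt hi

end CellAverages

/-! ### Markov kernels acting on bounded functions. -/

section Kernel

variable {M : ℕ} {a b : ℝ} {ν : Measure (Fin M → ℝ)} {κ : Kernel (Fin M → ℝ) (Fin M → ℝ)}

lemma integrable_of_abs_le {α : Type*} [MeasurableSpace α] {m : Measure α} [IsFiniteMeasure m]
    {h : α → ℝ} (hm : Measurable h) {B : ℝ} (hB : ∀ x, |h x| ≤ B) : Integrable h m :=
  Integrable.of_bound hm.aestronglyMeasurable B (Eventually.of_forall hB)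

lemma Kernel.measurable_integral [IsMarkovKernel κ] {h : (Fin M → ℝ) → ℝ} (hm : Measurable h) :
    Measurable fun x => ∫ x', h x' ∂(κ x) :=
  hm.stronglyMeasurable.integral_kernel.measurable

lemma Kernel.measurable_real (κ : Kernel (Fin M → ℝ) (Fin M → ℝ)) {A : Set (Fin M → ℝ)}
    (hA : MeasurableSet A) : Measurable fun x => (κ x).real A :=
  (κ.measurable_coe hA).ennreal_toReal

lemma Kernel.abs_integral_le [IsMarkovKernel κ] {h : (Fin M → ℝ) → ℝ} {B : ℝ}
    (hB : ∀ x, |h x| ≤ B) (x : Fin M → ℝ) : |∫ x', h x' ∂(κ x)| ≤ B := by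
  simpa using norm_integral_le_of_norm_le_const (μ := κ x) (f := h) (C := B)
    (Eventually.of_forall hB)

lemma integral_bind_kernel [IsMarkovKernel κ] {m : Measure (Fin M → ℝ)} [IsFiniteMeasure m]
    {h : (Fin M → ℝ) → ℝ} (hm : Measurable h) {B : ℝ} (hB : ∀ x, |h x| ≤ B) :
    ∫ x, h x ∂(m.bind κ) = ∫ x, ∫ x', h x' ∂(κ x) ∂m := by
  have hint : Integrable h (m.bind κ) := integrable_of_abs_le hm hB
  rw [Measure.comp_eq_comp_const_apply] at hint ⊢
  rw [Kernel.integral_comp hint, Kernel.const_apply]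

/-- A Markov kernel is a contraction on `L¹` of an invariant distribution. -/
lemma integral_abs_kernel_sub_le [IsMarkovKernel κ] [IsFiniteMeasure ν] (hν : Kernel.Invariant κ ν)
    {g h : (Fin M → ℝ) → ℝ} (hg : Measurable g) (hh : Measurable h) {B : ℝ}
    (hgB : ∀ x, |g x| ≤ B) (hhB : ∀ x, |h x| ≤ B) :
    ∫ x, |∫ x', g x' ∂(κ x) - ∫ x', h x' ∂(κ x)| ∂ν ≤ ∫ x, |g x - h x| ∂ν := by
  have hB : ∀ x, |(|g x - h x|)| ≤ B + B := fun x => by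
    rw [abs_abs]
    exact (abs_sub _ _).trans (add_le_add (hgB x) (hhB x))
  have hm : Measurable fun x => |g x - h x| := (hg.sub hh).abs
  -- Invariance replaces `ν` by its image under `κ`; what remains is the triangle inequality under
  -- each `κ x`.
  have e : ∫ x, |g x - h x| ∂ν = ∫ x, ∫ x', |g x' - h x'| ∂(κ x) ∂ν := by
    rw [← integral_bind_kernel hm hB]
    exact congrArg (fun m => ∫ x, |g x - h x| ∂m) hν.symm
  rw [e]
  refine integral_mono (integrable_of_abs_le (B := B + B)
      ((Kernel.measurable_integral hg).sub (Kernel.measurable_integral hh)).abs fun x => ?_)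
    (integrable_of_abs_le (Kernel.measurable_integral hm) (Kernel.abs_integral_le hB)) fun x => ?_
  · rw [abs_abs]
    exact (abs_sub _ _).trans
      (add_le_add (Kernel.abs_integral_le hgB x) (Kernel.abs_integral_le hhB x))
  · simp only
    rw [← integral_sub (integrable_of_abs_le hg hgB) (integrable_of_abs_le hh hhB)]
    exact abs_integral_le_integral_abs

end Kernel

/-! ### The Markov property in integrated form. -/

section Stationary

variable {Ω : Type*} [MeasurableSpace Ω] {P : Measure Ω} {M N : ℕ} {a b : ℝ}
  {X : ℕ → Ω → Fin M → ℝ} {κ : Kernel (Fin M → ℝ) (Fin M → ℝ)}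

/-- The `σ`-algebra generated by the states up to position `s`. -/
abbrev stateHistory (X : ℕ → Ω → Fin M → ℝ) (s : ℕ) : MeasurableSpace Ω :=
  ⨆ i ∈ Set.Iic s, MeasurableSpace.comap (X i) inferInstance

lemma stateHistory_le (hX : ∀ s, Measurable (X s)) (s : ℕ) :
    stateHistory X s ≤ ‹MeasurableSpace Ω› :=
  iSup₂_le fun i _ => (hX i).comap_le

omit [MeasurableSpace Ω] in
lemma measurable_stateHistory {i s : ℕ} (his : i ≤ s) : Measurable[stateHistory X s] (X i) :=
  (comap_measurable (X i)).mono
    (le_iSup₂_of_le (f := fun i (_ : i ∈ Set.Iic s) => MeasurableSpace.comap (X i) inferInstance)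
      i his le_rfl) le_rfl

namespace IsStationaryMarkov

/-- The Markov property as an identity of measures, obtained by integrating it over an event of the
past. The event `univ` yields stationarity, general events the Markov property for bounded
functions. -/
lemma map_restrict_succ [IsProbabilityMeasure P] [IsMarkovKernel κ] (h : IsStationaryMarkov P X κ)
    (hX : ∀ s, Measurable (X s)) (s : ℕ) {E : Set Ω} (hE : MeasurableSet[stateHistory X s] E) :
    (P.restrict E).map (X (s + 1)) = ((P.restrict E).map (X s)).bind κ := by
  ext A hA
  have hle := stateHistory_le hX s
  have hκ : Measurable fun x => κ x A := κ.measurable_coe hA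
  rw [Measure.bind_apply hA κ.measurable.aemeasurable, lintegral_map hκ (hX s),
    Measure.map_apply (hX (s + 1)) hA]
  have hind : Integrable ((X (s + 1) ⁻¹' A).indicator fun _ => (1 : ℝ)) P :=
    (integrable_const 1).indicator (hX (s + 1) hA)
  have h1 := setIntegral_condExp hle hind hE
  rw [setIntegral_congr_ae (g := fun ω => (κ (X s ω)).real A) (hle E hE)
    ((h.markov s A hA).mono fun ω hω _ => hω), integral_indicator_const _ (hX (s + 1) hA),
    smul_eq_mul, mul_one] at h1
  have hreal : ∀ x, κ x A = ENNReal.ofReal ((κ x).real A) := fun x =>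
    (ofReal_measureReal).symm
  simp_rw [hreal]
  rw [← ofReal_integral_eq_lintegral_ofReal _ (Eventually.of_forall fun _ => measureReal_nonneg),
    h1, ofReal_measureReal]
  exact integrable_of_abs_le (B := 1) ((Kernel.measurable_real κ hA).comp (hX s)) fun ω => by
    rw [abs_of_nonneg measureReal_nonneg]; exact measureReal_le_one

lemma map_eq [IsProbabilityMeasure P] [IsMarkovKernel κ] (h : IsStationaryMarkov P X κ)
    (hX : ∀ s, Measurable (X s)) (s : ℕ) : P.map (X s) = P.map (X 0) := by
  induction s with
  | zero => rfl
  | succ s ih =>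
    have := h.map_restrict_succ hX s (E := Set.univ) (@MeasurableSet.univ _ (_))
    rw [Measure.restrict_univ, ih] at this
    exact this.trans h.invariant

/-- The Markov property for bounded functions. -/
lemma integral_mul_succ [IsProbabilityMeasure P] [IsMarkovKernel κ]
    (h : IsStationaryMarkov P X κ) (hX : ∀ s, Measurable (X s)) (s : ℕ) {F : Ω → ℝ}
    (hF : Measurable[stateHistory X s] F) (hFint : Integrable F P) {g : (Fin M → ℝ) → ℝ}
    (hg : Measurable g) {B : ℝ} (hB : ∀ x, |g x| ≤ B) :
    ∫ ω, F ω * g (X (s + 1) ω) ∂P = ∫ ω, F ω * ∫ x, g x ∂(κ (X s ω)) ∂P := by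
  have hle := stateHistory_le hX s
  have hgX : Integrable (fun ω => g (X (s + 1) ω)) P :=
    integrable_of_abs_le (hg.comp (hX (s + 1))) fun _ => hB _
  have hKm := Kernel.measurable_integral (κ := κ) hg
  have hKX : Integrable (fun ω => ∫ x, g x ∂(κ (X s ω))) P :=
    integrable_of_abs_le (hKm.comp (hX s)) fun _ => Kernel.abs_integral_le hB _
  -- `markov` speaks of indicators only; the identity of measures in `map_restrict_succ` carries it
  -- over to bounded `g`.
  have hce : (fun ω => ∫ x, g x ∂(κ (X s ω))) =ᵐ[P]
      P[fun ω => g (X (s + 1) ω) | stateHistory X s] := by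
    refine ae_eq_condExp_of_forall_setIntegral_eq hle hgX (fun _ _ _ => hKX.integrableOn)
      (fun E hE _ => ?_) ((hKm.comp (measurable_stateHistory le_rfl)).aestronglyMeasurable)
    rw [← integral_map (f := fun x => ∫ x', g x' ∂(κ x)) (hX s).aemeasurable
      hKm.aestronglyMeasurable, ← integral_bind_kernel hg hB, ← h.map_restrict_succ hX s hE,
      integral_map (hX (s + 1)).aemeasurable hg.aestronglyMeasurable]
  have hmul : Integrable (F * fun ω => g (X (s + 1) ω)) P :=
    hFint.mul_bdd (hg.comp (hX (s + 1))).aestronglyMeasurable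
      (Eventually.of_forall fun ω => hB (X (s + 1) ω))
  have hpull := condExp_mul_of_stronglyMeasurable_left hF.stronglyMeasurable hmul hgX
  calc
    _ = ∫ ω, (P[F * fun ω => g (X (s + 1) ω) | stateHistory X s]) ω ∂P :=
      (integral_condExp hle).symm
    _ = _ := integral_congr_ae (by
      filter_upwards [hpull, hce] with ω h1 h2
      rw [h1, Pi.mul_apply, ← h2])

end IsStationaryMarkov

end Stationary

/-! ### The marginal quantization: duality with functions converging in `L¹(ν)`. -/

section Marginal

variable {Ω : Type*} [MeasurableSpace Ω] {P : Measure Ω} {M N : ℕ} {a b : ℝ}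
  {X : ℕ → Ω → Fin M → ℝ} {y : ℕ → Ω → Fin N → ℝ} {μ : ℕ → (Fin M → ℝ) → Fin N → ℝ}
  {S : ℕ → (Fin M → ℝ) → Matrix (Fin N) (Fin N) ℝ} {σ : ℝ}
  {κ : Kernel (Fin M → ℝ) (Fin M → ℝ)}

omit [MeasurableSpace Ω] in
lemma marginalQuantization_eq_gridPoint_iff (hab : a < b) (n t : ℕ) (ω : Ω) (l : GridIndex M n) :
    marginalQuantization a b X n t ω = gridPoint a b n l ↔ cellIndex a b n (X t ω) = l :=
  quantizer_eq_gridPoint_iff hab n (X t ω) l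

lemma measurableSet_cellIndex_state (hX : ∀ s, Measurable (X s)) (n s : ℕ) (l : GridIndex M n) :
    MeasurableSet {ω | cellIndex a b n (X s ω) = l} :=
  hX s (measurableSet_cellIndex_eq a b n l)

namespace IsStationaryMarkov

lemma measureReal_cellIndex [IsProbabilityMeasure P] [IsMarkovKernel κ]
    (h : IsStationaryMarkov P X κ) (hX : ∀ s, Measurable (X s)) (n s : ℕ) (l : GridIndex M n) :
    P.real {ω | cellIndex a b n (X s ω) = l} =
      (P.map (X 0)).real {x | cellIndex a b n x = l} := by
  rw [← h.map_eq hX s, map_measureReal_apply (hX s) (measurableSet_cellIndex_eq a b n l)]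
  rfl

/-- The joint law of the cells occupied at consecutive times does not depend on time. -/
lemma measureReal_inter_cellIndex [IsProbabilityMeasure P] [IsMarkovKernel κ]
    (h : IsStationaryMarkov P X κ) (hX : ∀ s, Measurable (X s)) (n s : ℕ) (i j : GridIndex M n) :
    P.real ({ω | cellIndex a b n (X s ω) = j} ∩ {ω | cellIndex a b n (X (s + 1) ω) = i}) =
      ∫ x in {x | cellIndex a b n x = j}, (κ x).real {x | cellIndex a b n x = i}
        ∂(P.map (X 0)) := by
  have hi := measurableSet_cellIndex_eq (M := M) a b n i
  have hj := measurableSet_cellIndex_eq (M := M) a b n j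
  have h1 := setIntegral_condExp (stateHistory_le hX s)
    ((integrable_const (μ := P) (1 : ℝ)).indicator (hX (s + 1) hi))
    (measurable_stateHistory (X := X) le_rfl hj)
  rw [setIntegral_congr_ae (g := fun ω => (κ (X s ω)).real {x | cellIndex a b n x = i}) (hX s hj)
    ((h.markov s _ hi).mono fun ω hω _ => hω), integral_indicator_const _ (hX (s + 1) hi),
    smul_eq_mul, mul_one, measureReal_restrict_apply (hX (s + 1) hi)] at h1
  rw [← h.map_eq hX s, setIntegral_map hj
    (Kernel.measurable_real κ hi).aestronglyMeasurable (hX s).aemeasurable, Set.inter_comm]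
  exact h1.symm

/-- By stationarity the joint law of consecutive cells is the same at all times, so the conditional
probabilities from position 0 to position 1 serve throughout. Cells of probability zero receive a
column of the identity. -/
lemma exists_isTransitionMatrix [IsProbabilityMeasure P] [IsMarkovKernel κ]
    (h : IsStationaryMarkov P X κ) (hab : a < b) (hX : ∀ s, Measurable (X s)) (n : ℕ) :
    ∃ A, IsTransitionMatrix P a b n (marginalQuantization a b X n) A := by
  classical
  refine ⟨Matrix.of fun i j => if P {ω | cellIndex a b n (X 0 ω) = j} = 0 then
    (if i = j then 1 else 0) else
      (P[|{ω | cellIndex a b n (X 0 ω) = j}]).real {ω | cellIndex a b n (X 1 ω) = i}, ?_, ?_, ?_⟩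
  · intro i j
    rw [Matrix.of_apply]
    split_ifs
    exacts [zero_le_one, le_rfl, measureReal_nonneg]
  · intro j
    simp only [Matrix.of_apply]
    split_ifs with hj
    · simp
    · have := cond_isProbabilityMeasure hj
      have := sum_setIntegral_fiber (P := P[|{ω | cellIndex a b n (X 0 ω) = j}])
        (measurableSet_cellIndex_state (a := a) (b := b) hX n 1) (integrable_const (1 : ℝ))
      simpa using this
  · intro t i j hne
    simp only [marginalQuantization_eq_gridPoint_iff hab] at hne ⊢
    have hlaw : P {ω | cellIndex a b n (X 0 ω) = j} ≠ 0 := by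
      rw [← measureReal_ne_zero_iff] at hne ⊢
      rwa [h.measureReal_cellIndex hX, ← h.measureReal_cellIndex hX n t]
    rw [Matrix.of_apply, if_neg hlaw,
      cond_real_eq (measurableSet_cellIndex_state hX n 0 j),
      cond_real_eq (measurableSet_cellIndex_state hX n t j), h.measureReal_cellIndex hX,
      h.measureReal_cellIndex hX n t, h.measureReal_inter_cellIndex hX n t,
      ← h.measureReal_inter_cellIndex hX n 0]

/-- One backward step of a transition matrix is a cell average of one backward step of the
kernel. -/
lemma vecMul_mul_measureReal [IsProbabilityMeasure P] [IsMarkovKernel κ]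
    (h : IsStationaryMarkov P X κ) (hab : a < b) (hX : ∀ s, Measurable (X s)) {n : ℕ}
    {A : Matrix (GridIndex M n) (GridIndex M n) ℝ}
    (hA : IsTransitionMatrix P a b n (marginalQuantization a b X n) A) (c : GridIndex M n → ℝ)
    (j : GridIndex M n) :
    Matrix.vecMul c A j * (P.map (X 0)).real {x | cellIndex a b n x = j} =
      ∫ x in {x | cellIndex a b n x = j}, ∫ x', c (cellIndex a b n x') ∂(κ x)
        ∂(P.map (X 0)) := by
  have hfib := measurableSet_cellIndex_eq (M := M) a b n
  have h1 : ∀ x, ∫ x', c (cellIndex a b n x') ∂(κ x) =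
      ∑ i, c i * (κ x).real {x | cellIndex a b n x = i} := fun x => by
    have := sum_mul_setIntegral_fiber (P := κ x) hfib c (integrable_const (1 : ℝ))
    simpa using this.symm
  simp_rw [h1]
  rw [integral_finsetSum _ fun i _ => ((integrable_of_abs_le (B := 1)
    (Kernel.measurable_real κ (hfib i)) fun x => ?_).const_mul (c i)).integrableOn]
  swap
  · rw [abs_of_nonneg measureReal_nonneg]; exact measureReal_le_one
  simp_rw [integral_const_mul, ← h.measureReal_inter_cellIndex hX n 0,
    ← h.measureReal_cellIndex (a := a) (b := b) hX n 0, Matrix.vecMul, dotProduct, Finset.sum_mul,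
    mul_assoc]
  refine Finset.sum_congr rfl fun i _ => ?_
  congr 1
  -- Over a null cell the column of `A` is arbitrary, but both sides vanish.
  by_cases hne : P {ω | cellIndex a b n (X 0 ω) = j} = 0
  · rw [(measureReal_eq_zero_iff).2 hne, mul_zero, eq_comm, measureReal_eq_zero_iff]
    exact measure_mono_null Set.inter_subset_left hne
  · rw [hA.eq_cond 0 i j (by simpa only [marginalQuantization_eq_gridPoint_iff hab] using hne)]
    simp only [marginalQuantization_eq_gridPoint_iff hab]
    rw [cond_real_eq (measurableSet_cellIndex_state hX n 0 j), mul_comm, mul_inv_cancel_left₀]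
    exact (measureReal_ne_zero_iff).2 hne

end IsStationaryMarkov

lemma IsTransitionMatrix.abs_vecMul_le {n : ℕ} {XL : ℕ → Ω → Fin M → ℝ}
    {A : Matrix (GridIndex M n) (GridIndex M n) ℝ} (hA : IsTransitionMatrix P a b n XL A)
    {c : GridIndex M n → ℝ} {B : ℝ} (hc : ∀ l, |c l| ≤ B) (j : GridIndex M n) :
    |Matrix.vecMul c A j| ≤ B := by
  calc
    |Matrix.vecMul c A j| ≤ ∑ i, |c i * A i j| := Finset.abs_sum_le_sum_abs _ _
    _ ≤ ∑ i, B * A i j := Finset.sum_le_sum fun i _ => by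
      rw [abs_mul, abs_of_nonneg (hA.nonneg i j)]
      exact mul_le_mul_of_nonneg_right (hc i) (hA.nonneg i j)
    _ = B := by rw [← Finset.mul_sum, hA.sum_col, mul_one]

/-- The weights `w i` on the grids of resolution `u i` converge to the law of `X s`, weighted with
`V`: sums of uniformly bounded functions on the grids that converge in mean with respect to the
stationary distribution converge to the corresponding expectation. -/
def WeightsTendsto (P : Measure Ω) (a b : ℝ) (X : ℕ → Ω → Fin M → ℝ) {ι : Type*} (𝓕 : Filter ι)
    (u : ι → ℕ) (w : ∀ i, GridIndex M (u i) → ℝ) (s : ℕ) (V : Ω → ℝ) : Prop :=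
  ∀ (c : ∀ i, GridIndex M (u i) → ℝ) (g : (Fin M → ℝ) → ℝ) (B : ℝ), (∀ i l, |c i l| ≤ B) →
    Measurable g → (∀ x, |g x| ≤ B) →
    Tendsto (fun i => ∫ x, |c i (cellIndex a b (u i) x) - g x| ∂(P.map (X 0))) 𝓕 (𝓝 0) →
    Tendsto (fun i => ∑ l, c i l * w i l) 𝓕 (𝓝 (∫ ω, V ω * g (X s ω) ∂P))

section Weights

variable {ι : Type*} {𝓕 : Filter ι} {u : ι → ℕ}

/-- The initial weights are the `ν`-masses of the cells, so the error is at most the `L¹(ν)`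
distance of the test functions. -/
lemma weightsTendsto_init [IsProbabilityMeasure P] (hab : a < b) (hX : ∀ s, Measurable (X s)) :
    WeightsTendsto P a b X 𝓕 u
      (fun i l => P.real {ω | quantizer a b (u i) (X 0 ω) = gridPoint a b (u i) l}) 0
      fun _ => 1 := by
  intro c g B hc hg hgB hlim
  have := Measure.isProbabilityMeasure_map (μ := P) (hX 0).aemeasurable
  have h1 : ∀ i, ∑ l, c i l * P.real {ω | quantizer a b (u i) (X 0 ω) = gridPoint a b (u i) l} =
      ∫ x, c i (cellIndex a b (u i) x) ∂(P.map (X 0)) := fun i => by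
    have := sum_mul_setIntegral_fiber (P := P.map (X 0))
      (measurableSet_cellIndex_eq (M := M) a b (u i)) (c i) (integrable_const (1 : ℝ))
    simp only [mul_one] at this
    rw [← this]
    refine Finset.sum_congr rfl fun l _ => ?_
    simp only [quantizer_eq_gridPoint_iff hab]
    rw [setIntegral_const, smul_eq_mul, mul_one,
      map_measureReal_apply (hX 0) (measurableSet_cellIndex_eq a b (u i) l)]
    rfl
  simp only [h1, one_mul]
  rw [← integral_map (hX 0).aemeasurable hg.aestronglyMeasurable, tendsto_iff_dist_tendsto_zero]
  refine squeeze_zero (fun _ => dist_nonneg) (fun i => ?_) hlim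
  rw [Real.dist_eq, ← integral_sub (integrable_comp_cellIndex (u i) (c i))
    (integrable_of_abs_le hg hgB)]
  exact abs_integral_le_integral_abs

/-- The matrix is moved onto the test function. There it acts as the kernel followed by cell
averaging, both compatible with `L¹(ν)` limits; the limit `∫ g dκ` is turned back into `g` at the
next state by the Markov property. -/
lemma WeightsTendsto.mulVec [IsProbabilityMeasure P] [IsMarkovKernel κ]
    (h : IsStationaryMarkov P X κ) (hab : a < b) (hX : ∀ s, Measurable (X s))
    (hbox : ∀ᵐ ω ∂P, X 0 ω ∈ stateBox M a b) (hu : Tendsto u 𝓕 atTop)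
    {A : ∀ i, Matrix (GridIndex M (u i)) (GridIndex M (u i)) ℝ}
    (hA : ∀ i, IsTransitionMatrix P a b (u i) (marginalQuantization a b X (u i)) (A i))
    {w : ∀ i, GridIndex M (u i) → ℝ} {s : ℕ} {V : Ω → ℝ} (hV : Measurable[stateHistory X s] V)
    (hVint : Integrable V P) (hw : WeightsTendsto P a b X 𝓕 u w s V) :
    WeightsTendsto P a b X 𝓕 u (fun i => (A i).mulVec (w i)) (s + 1) V := by
  intro c g B hc hg hgB hlim
  have := Measure.isProbabilityMeasure_map (μ := P) (hX 0).aemeasurable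
  have hbox' : ∀ᵐ x ∂(P.map (X 0)), x ∈ stateBox M a b :=
    (ae_map_iff (hX 0).aemeasurable isCompact_stateBox.measurableSet).2 hbox
  have hcm : ∀ i, Measurable fun x => c i (cellIndex a b (u i) x) := fun i =>
    (measurable_of_countable (c i)).comp (measurable_cellIndex (u i))
  have hcB : ∀ i x, |c i (cellIndex a b (u i) x)| ≤ B := fun i x => hc i _
  have hKg := Kernel.measurable_integral (κ := κ) hg
  rw [h.integral_mul_succ hX s hV hVint hg hgB]
  have key := hw (fun i => Matrix.vecMul (c i) (A i)) (fun x => ∫ x', g x' ∂(κ x)) B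
    (fun i => (hA i).abs_vecMul_le (hc i)) hKg (Kernel.abs_integral_le hgB) ?_
  · refine key.congr fun i => ?_
    exact (Matrix.dotProduct_mulVec (c i) (A i) (w i)).symm
  · refine tendsto_integral_abs_cell_sub hab hbox' hu
      (g' := fun i x => ∫ x', c i (cellIndex a b (u i) x') ∂(κ x))
      (integrable_of_abs_le hKg (Kernel.abs_integral_le hgB))
      (fun i => integrable_of_abs_le (Kernel.measurable_integral (hcm i))
        (Kernel.abs_integral_le (hcB i)))
      (fun i j => h.vecMul_mul_measureReal hab hX (hA i) (c i) j) ?_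
    exact squeeze_zero (fun _ => integral_nonneg fun _ => abs_nonneg _)
      (fun i => integral_abs_kernel_sub_le h.invariant (hcm i) hg (hcB i) hgB) hlim

/-- The likelihood is absorbed into the test function. It is bounded, and its values at the
quantized states and at `z i` converge in `L¹(ν)` by joint continuity. Dominated convergence is the
reason for the countably generated filter. -/
lemma WeightsTendsto.mul_likelihood [IsProbabilityMeasure P] [𝓕.IsCountablyGenerated]
    (hsys : IsObservedSystem P a b X y μ S σ) (hu : Tendsto u 𝓕 atTop) (t : ℕ)
    {z : ι → Fin N → ℝ} {z₀ : Fin N → ℝ} (hz : Tendsto z 𝓕 (𝓝 z₀))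
    {w : ∀ i, GridIndex M (u i) → ℝ} {s : ℕ} {V : Ω → ℝ}
    (hw : WeightsTendsto P a b X 𝓕 u w s V) :
    WeightsTendsto P a b X 𝓕 u
      (fun i l => likelihood μ S σ t (gridPoint a b (u i) l) (z i) * w i l) s
      (fun ω => V ω * boxLikelihood a b μ S σ t (X s ω) z₀) := by
  intro c g B hc hg hgB hlim
  have hX := hsys.measurable_state
  have := Measure.isProbabilityMeasure_map (μ := P) (hX 0).aemeasurable
  have hbox : ∀ᵐ x ∂(P.map (X 0)), x ∈ stateBox M a b :=
    (ae_map_iff (hX 0).aemeasurable isCompact_stateBox.measurableSet).2 (hsys.mem_box 0)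
  obtain ⟨Bℓ, hBℓ⟩ := hsys.exists_boxLikelihood_le t
  have hℓ0 : ∀ x z, 0 ≤ boxLikelihood a b μ S σ t x z := fun x z =>
    (hsys.boxLikelihood_pos t x z).le
  have hℓa : ∀ x z, |boxLikelihood a b μ S σ t x z| ≤ Bℓ := fun x z => by
    rw [abs_of_nonneg (hℓ0 x z)]; exact hBℓ x z
  have hℓc : ∀ z, Continuous fun x => boxLikelihood a b μ S σ t x z := fun z =>
    Continuous.comp (f := fun x : Fin M → ℝ => (x, z)) (hsys.continuous_boxLikelihood t)
      (continuous_id.prodMk continuous_const)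
  have hB0 : 0 ≤ B := (abs_nonneg _).trans (hgB 0)
  have hBℓ0 : 0 ≤ Bℓ := (hℓ0 0 0).trans (hBℓ 0 0)
  have hprod : ∀ {p q : ℝ}, |p| ≤ B → |q| ≤ Bℓ → |p * q| ≤ B * Bℓ := fun hp hq => by
    rw [abs_mul]; exact mul_le_mul hp hq (abs_nonneg _) hB0
  have hdiff : Tendsto (fun i => ∫ x, |boxLikelihood a b μ S σ t (quantizer a b (u i) x) (z i) -
      boxLikelihood a b μ S σ t x z₀| ∂(P.map (X 0))) 𝓕 (𝓝 0) := by
    have h0 : ∫ _, (0 : ℝ) ∂(P.map (X 0)) = 0 := integral_zero _ _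
    rw [← h0]
    refine tendsto_integral_filter_of_dominated_convergence (fun _ => Bℓ + Bℓ)
      (Eventually.of_forall fun i => ?_) (Eventually.of_forall fun i => Eventually.of_forall
        fun x => ?_) (integrable_const _) ?_
    · exact (((hℓc (z i)).measurable.comp (measurable_quantizer (u i))).sub
        (hℓc z₀).measurable).abs.aestronglyMeasurable
    · rw [Real.norm_eq_abs, abs_abs]
      exact (abs_sub _ _).trans (add_le_add (hℓa _ _) (hℓa _ _))
    · filter_upwards [hbox] with x hx
      have h1 := ((hsys.continuous_boxLikelihood t).tendsto (x, z₀)).comp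
        (((tendsto_quantizer hsys.lt hx).comp hu).prodMk_nhds hz)
      simpa using (h1.sub_const (boxLikelihood a b μ S σ t x z₀)).abs
  have key := hw (fun i l => c i l * likelihood μ S σ t (gridPoint a b (u i) l) (z i))
    (fun x => g x * boxLikelihood a b μ S σ t x z₀) (B * Bℓ)
    (fun i l => hprod (hc i l) (by
      rw [← boxLikelihood_eq (gridPoint_mem hsys.lt (u i) l)]; exact hℓa _ _))
    (hg.mul (hℓc z₀).measurable) (fun x => hprod (hgB x) (hℓa _ _)) ?_
  · simp only [mul_assoc] at key ⊢
    simpa only [mul_comm (g _)] using key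
  · have hsum : Tendsto (fun i => Bℓ * ∫ x, |c i (cellIndex a b (u i) x) - g x| ∂(P.map (X 0)) +
        B * ∫ x, |boxLikelihood a b μ S σ t (quantizer a b (u i) x) (z i) -
          boxLikelihood a b μ S σ t x z₀| ∂(P.map (X 0))) 𝓕 (𝓝 0) := by
      simpa using (hlim.const_mul Bℓ).add (hdiff.const_mul B)
    refine squeeze_zero (fun _ => integral_nonneg fun _ => abs_nonneg _) (fun i => ?_) hsum
    have hcint := (integrable_comp_cellIndex (a := a) (b := b) (ν := P.map (X 0)) (u i) (c i)).sub
      (integrable_of_abs_le hg hgB)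
    have hQint : Integrable (fun x => boxLikelihood a b μ S σ t (quantizer a b (u i) x) (z i) -
        boxLikelihood a b μ S σ t x z₀) (P.map (X 0)) :=
      (integrable_of_abs_le ((hℓc (z i)).measurable.comp (measurable_quantizer (u i)))
        fun x => hℓa _ _).sub (integrable_of_abs_le (hℓc z₀).measurable fun x => hℓa _ _)
    rw [← integral_const_mul, ← integral_const_mul]
    refine le_trans (integral_mono_of_nonneg (Eventually.of_forall fun _ => abs_nonneg _)
      ((hcint.abs.const_mul Bℓ).add (hQint.abs.const_mul B)) (Eventually.of_forall fun x => ?_))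
      (integral_add (hcint.abs.const_mul Bℓ) (hQint.abs.const_mul B)).le
    simp only [Pi.add_apply, Pi.sub_apply]
    rw [← boxLikelihood_eq (gridPoint_mem hsys.lt (u i) _)]
    change |c i _ * boxLikelihood a b μ S σ t (quantizer a b (u i) x) (z i) - _| ≤ _
    -- The difference of products is split so that each difference is multiplied by a bounded
    -- factor.
    have e : c i (cellIndex a b (u i) x) * boxLikelihood a b μ S σ t (quantizer a b (u i) x) (z i) -
        g x * boxLikelihood a b μ S σ t x z₀ =
        boxLikelihood a b μ S σ t (quantizer a b (u i) x) (z i) *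
          (c i (cellIndex a b (u i) x) - g x) +
        g x * (boxLikelihood a b μ S σ t (quantizer a b (u i) x) (z i) -
          boxLikelihood a b μ S σ t x z₀) := by ring
    rw [e]
    refine (abs_add_le _ _).trans (add_le_add ?_ ?_)
    · rw [abs_mul]; exact mul_le_mul_of_nonneg_right (hℓa _ _) (abs_nonneg _)
    · rw [abs_mul]; exact mul_le_mul_of_nonneg_right (hgB _) (abs_nonneg _)

end Weights

namespace IsStationaryMarkov

lemma measurable_pathWeight_stateHistory (hsys : IsObservedSystem P a b X y μ S σ)
    (z : ℕ → Fin N → ℝ) {t s : ℕ} (hts : t ≤ s) :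
    Measurable[stateHistory X s] fun ω => pathWeight a b μ S σ (fun s => X s ω) z t := by
  simp only [pathWeight]
  refine Finset.measurable_prod _ fun i hi => ?_
  have hc : Continuous fun x : Fin M → ℝ => boxLikelihood a b μ S σ i x (z i) :=
    Continuous.comp (f := fun x : Fin M → ℝ => (x, z i)) (hsys.continuous_boxLikelihood i)
      (continuous_id.prodMk continuous_const)
  exact hc.measurable.comp (measurable_stateHistory
    (Nat.succ_le_of_lt ((Finset.mem_range.1 hi).trans_le hts)))

lemma weightsTendsto_gridRecursion [IsProbabilityMeasure P] [IsMarkovKernel κ]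
    (h : IsStationaryMarkov P X κ) (hsys : IsObservedSystem P a b X y μ S σ)
    {A : ∀ n, Matrix (GridIndex M n) (GridIndex M n) ℝ}
    (hA : ∀ n, IsTransitionMatrix P a b n (marginalQuantization a b X n) (A n))
    (z₀ : ℕ → Fin N → ℝ) (t : ℕ) :
    WeightsTendsto P a b X (atTop ×ˢ 𝓝 z₀) (fun p : ℕ × (ℕ → Fin N → ℝ) => p.1)
      (fun p => gridRecursion P a b μ S σ (X 0) p.1 (A p.1) p.2 t) t
      fun ω => pathWeight a b μ S σ (fun s => X s ω) z₀ t := by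
  induction t with
  | zero =>
    simp only [pathWeight, Finset.range_zero, Finset.prod_empty]
    exact weightsTendsto_init hsys.lt hsys.measurable_state
  | succ t ih =>
    have h1 := ih.mulVec h hsys.lt hsys.measurable_state (hsys.mem_box 0) tendsto_fst
      (fun p => hA p.1) (measurable_pathWeight_stateHistory hsys z₀ le_rfl)
      (hsys.integrable_pathWeight z₀ t)
    have hz : Tendsto (fun p : ℕ × (ℕ → Fin N → ℝ) => p.2 t) (atTop ×ˢ 𝓝 z₀) (𝓝 (z₀ t)) :=
      ((continuous_apply t).tendsto z₀).comp tendsto_snd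
    have h2 := h1.mul_likelihood hsys tendsto_fst t hz
    simp only [pathWeight_succ]
    intro c g B
    simp only [gridRecursion_succ]
    exact h2 c g B

lemma weightsTendsto_pow_mulVec [IsProbabilityMeasure P] [IsMarkovKernel κ]
    (h : IsStationaryMarkov P X κ) (hsys : IsObservedSystem P a b X y μ S σ)
    {A : ∀ n, Matrix (GridIndex M n) (GridIndex M n) ℝ}
    (hA : ∀ n, IsTransitionMatrix P a b n (marginalQuantization a b X n) (A n))
    (z₀ : ℕ → Fin N → ℝ) (t ρ : ℕ) :
    WeightsTendsto P a b X (atTop ×ˢ 𝓝 z₀) (fun p : ℕ × (ℕ → Fin N → ℝ) => p.1)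
      (fun p => (A p.1 ^ ρ).mulVec (gridRecursion P a b μ S σ (X 0) p.1 (A p.1) p.2 t)) (t + ρ)
      fun ω => pathWeight a b μ S σ (fun s => X s ω) z₀ t := by
  induction ρ with
  | zero => simpa using h.weightsTendsto_gridRecursion hsys hA z₀ t
  | succ ρ ih =>
    have h1 := ih.mulVec h hsys.lt hsys.measurable_state (hsys.mem_box 0) tendsto_fst
      (fun p => hA p.1) (measurable_pathWeight_stateHistory hsys z₀ (Nat.le_add_right t ρ))
      (hsys.integrable_pathWeight z₀ t)
    simp only [Matrix.mulVec_mulVec, ← pow_succ'] at h1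
    exact h1

/-- Convergence of the grid based estimates for the marginal quantization. Since only convergence
in mean of the cell averages is used, conditional regularity of the kernel is not needed. -/
theorem gridEstimatesConverge [IsProbabilityMeasure P] [IsMarkovKernel κ]
    (h : IsStationaryMarkov P X κ) (hsys : IsObservedSystem P a b X y μ S σ) (T : ℕ)
    {K : Set (ℕ → Fin N → ℝ)} (hK : IsCompact K) :
    GridEstimatesConverge P a b X y μ S σ (marginalQuantization a b X) T
      {ω | (fun i => y i ω) ∈ K} := by
  have hX := hsys.measurable_state
  have := Measure.isProbabilityMeasure_map (μ := P) (hX 0).aemeasurable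
  refine hsys.gridEstimatesConverge T hK (h.exists_isTransitionMatrix hsys.lt hX)
    fun A hA t ρ φ B hφ hB z₀ => ?_
  exact h.weightsTendsto_pow_mulVec hsys hA z₀ t ρ (fun p l => φ (gridPoint a b p.1 l)) φ B
    (fun _ _ => hB _) hφ.measurable hB ((tendsto_integral_abs_quantizer_sub hsys.lt
      ((ae_map_iff (hX 0).aemeasurable isCompact_stateBox.measurableSet).2 (hsys.mem_box 0))
      hφ hB).comp tendsto_fst)

end IsStationaryMarkov

end Marginal

theorem theorem5 {Ω : Type*} [MeasurableSpace Ω] (P : Measure Ω) [IsProbabilityMeasure P]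
    {M N : ℕ} (a b : ℝ) (X : ℕ → Ω → Fin M → ℝ) (y : ℕ → Ω → Fin N → ℝ)
    (μ : ℕ → (Fin M → ℝ) → Fin N → ℝ) (S : ℕ → (Fin M → ℝ) → Matrix (Fin N) (Fin N) ℝ) (σ : ℝ)
    (hsys : IsObservedSystem P a b X y μ S σ)
    (T : ℕ) (C : ℝ) (hC : 1 ≤ C) :
    ∃ G : Set Ω, MeasurableSet G ∧
      1 - ((T : ℝ) + 1) ^ (1 - C * (N : ℝ)) * Real.exp (-(C * (N : ℝ))) ≤ P.real G ∧
      (∀ (MW : ℕ) (f : (Fin M → ℝ) → (Fin MW → ℝ) → (Fin M → ℝ)) (WS : Set (Fin MW → ℝ))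
          (W : ℕ → Ω → Fin MW → ℝ),
        IsLipschitzModel P a b X f WS W →
        GridEstimatesConverge P a b X y μ S σ (markovianQuantization a b f W (X 0)) T G) ∧
      (∀ (κ : Kernel (Fin M → ℝ) (Fin M → ℝ)) [IsMarkovKernel κ],
        IsStationaryMarkov P X κ →
        (IsCRT1 κ (P.map (X 0)) a b ∨ IsCRT2 κ (P.map (X 0)) a b) →
        GridEstimatesConverge P a b X y μ S σ (marginalQuantization a b X) T G) := by
  -- Tightness reaches any probability below 1, in particular the required one. `K` is chosen before
  -- any state model and depends only on the law of the observations.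
  obtain ⟨K, hK, hKm, hKP⟩ := hsys.exists_isCompact_obs
    (ε := ((T : ℝ) + 1) ^ (1 - C * (N : ℝ)) * Real.exp (-(C * (N : ℝ)))) (by positivity)
  exact ⟨{ω | (fun i => y i ω) ∈ K}, hKm, hKP,
    fun _ _ _ _ hmodel => hmodel.gridEstimatesConverge hsys T hK,
    fun _ _ hmarkov _ => hmarkov.gridEstimatesConverge hsys T hK⟩
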